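/- Let $n\ge 1$ be an integer, $B_n=\{z\in\mathbb C^n:|z|<1\}$, $S_n=\partial B_n$, and let $\sigma$ be the rotation-invariant probability measure on $S_n$. For $m>0$, the Hardy space $H^m(B_n)$ consists of the holomorphic functions $h:B_n\to\mathbb C$ with $$\|h\|_m=\sup_{0\le r<1}\Big(\int_{S_n}|h(r\xi)|^m\,d\sigma(\xi)\Big)^{1/m}<\infty .$$ For real $p,q,s$ with $p>0$, the general Hardy type space $H^{p,q,s}(B_n)$ consists of the holomorphic functions $h:B_n\to\mathbb C$ with $$\|h\|_{p,q,s}=\sup_{0\le r<1}\ \sup_{a\in B_n}\Big((1-r^2)^q\int_{S_n}|h(r\xi)|^p\,(1-|\varphi_a(r\xi)|^2)^s\,d\sigma(\xi)\Big)^{1/p}<\infty,$$ where $\varphi_a$ is the involutive holomorphic automorphism of $B_n$ exchanging $0$ and $a$, namely $$\varphi_a(z)=\frac{a-P_az-\sqrt{1-|a|^2}\,(z-P_az)}{1-\langle z,a\rangle},$$ with $P_a$ the orthogonal projection onto $\mathbb C a$. For a holomorphic map $\varphi:B_n\to B_n$ let $C_\varphi g=g\circ\varphi$. We call $C_\varphi$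 compact from $X$ to $Y$ if it maps $X$ into $Y$ and, for every bounded sequence $(u_k)$ in $X$, the sequence $(C_\varphi u_k)$ has a subsequence converging in $Y$; here boundedness and convergence refer to the (quasi-)norms above. **Theorem 3.2.** Let $p>0$, $0<s<n$ and $q+s\ge 0$ (so that $q+n>0$), and let $\varphi:B_n\to B_n$ be holomorphic. (a) If $C_\varphi$ is compact from $H^{\frac{pn}{q+n}}(B_n)$ to $H^{p,q,s}(B_n)$, then $$\lim_{|w|\to1^-}\frac{1-|w|^2}{1-|\varphi(w)|^2}=0.$$ (b) If $C_\varphi$ is compact from $H^{\frac{pn}{q+n}}(B_n)$ to itself, then $C_\varphi$ is compact from $H^{\frac{pn}{q+n}}(B_n)$ to $H^{p,q,s}(B_n)$. -/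

import Mathlib

open Set Filter Topology MeasureTheory
open scoped NNReal ENNReal

noncomputable section

/-- The complex vector space of dimension `n`, with its Hermitian inner product and norm. The
Hermitian product of `w` and `u`, linear in `w` and conjugate linear in `u`, is `inner ℂ u w`. -/
abbrev CSpace (n : ℕ) : Type := EuclideanSpace ℂ (Fin n)

/-- The open unit ball `B_n`. -/
def unitBall (n : ℕ) : Set (CSpace n) := Metric.ball 0 1

/-- The unit sphere `S_n`, the boundary of `B_n`. -/
abbrev UnitSphere (n : ℕ) : Type := Metric.sphere (0 : CSpace n) 1

/-- The rotation invariant surface measure on `S_n`, normalized to have total mass `1`. -/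
def sphereMeasure (n : ℕ) : Measure (UnitSphere n) :=
  ((volume : Measure (CSpace n)).toSphere univ)⁻¹ • (volume : Measure (CSpace n)).toSphere

/-- The orthogonal projection of `z` onto the complex line spanned by `a` (zero if `a = 0`). -/
def lineProj {n : ℕ} (a z : CSpace n) : CSpace n := (inner ℂ a z / inner ℂ a a) • a

/-- The involutive automorphism `φ_a` of `B_n` exchanging `0` and `a`:
`φ_a(z) = (a - P_a z - √(1 - |a|²) (z - P_a z)) / (1 - ⟨z, a⟩)`. -/
def ballInvolution {n : ℕ} (a z : CSpace n) : CSpace n :=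
  (1 - inner ℂ a z)⁻¹ •
    (a - lineProj a z - ((Real.sqrt (1 - ‖a‖ ^ 2) : ℝ) : ℂ) • (z - lineProj a z))

/-- The Hardy space (quasi-)norm
`‖h‖_p = sup_{0 ≤ r < 1} (∫_{S_n} |h(rξ)|^p dσ(ξ))^{1/p}`, with values in `[0, ∞]`. -/
def hardyNorm {n : ℕ} (p : ℝ) (h : CSpace n → ℂ) : ℝ≥0∞ :=
  ⨆ r ∈ Ico (0 : ℝ) 1,
    (∫⁻ ξ : UnitSphere n, ‖h (r • (ξ : CSpace n))‖ₑ ^ p ∂(sphereMeasure n)) ^ (1 / p)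

/-- The Hardy space `H^p(B_n)`. A function on `B_n` is represented by a function on the whole
space; its values outside `B_n` play no role. -/
def hardySpace (n : ℕ) (p : ℝ) : Set (CSpace n → ℂ) :=
  {h | DifferentiableOn ℂ h (unitBall n) ∧ hardyNorm p h < ∞}

/-- The integral mean
`M_{p,q,s}(r,f) = sup_{a ∈ B_n} ((1-r²)^q ∫_{S_n} |f(rξ)|^p (1-|φ_a(rξ)|²)^s dσ(ξ))^{1/p}`. -/
def generalHardyMean {n : ℕ} (p q s r : ℝ) (f : CSpace n → ℂ) : ℝ≥0∞ :=
  ⨆ a ∈ unitBall n,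
    (ENNReal.ofReal ((1 - r ^ 2) ^ q) *
      ∫⁻ ξ : UnitSphere n, ‖f (r • (ξ : CSpace n))‖ₑ ^ p *
        ENNReal.ofReal ((1 - ‖ballInvolution a (r • (ξ : CSpace n))‖ ^ 2) ^ s)
          ∂(sphereMeasure n)) ^ (1 / p)

/-- The (quasi-)norm `‖f‖_{p,q,s} = sup_{0 ≤ r < 1} M_{p,q,s}(r,f)`, with values in `[0, ∞]`. -/
def generalHardyNorm {n : ℕ} (p q s : ℝ) (f : CSpace n → ℂ) : ℝ≥0∞ :=
  ⨆ r ∈ Ico (0 : ℝ) 1, generalHardyMean p q s r f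

/-- The general Hardy type space `H^{p,q,s}(B_n)`. -/
def generalHardySpace (n : ℕ) (p q s : ℝ) : Set (CSpace n → ℂ) :=
  {h | DifferentiableOn ℂ h (unitBall n) ∧ generalHardyNorm p q s h < ∞}

/-- The composition operator `C_φ g = g ∘ φ`. -/
def compositionOperator {n : ℕ} (φ : CSpace n → CSpace n) (g : CSpace n → ℂ) : CSpace n → ℂ :=
  g ∘ φ

/-- `T` is a compact operator from the function space `X`, with (quasi-)norm `NX`, to the function
space `Y`, with (quasi-)norm `NY`: it maps `X` into `Y`, and for every bounded sequence in `X` the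
sequence of images has a subsequence converging in `Y`. As convergence for the metric
`NY (f - g) ^ p` is convergence for `NY (f - g)`, this covers the quasi-normed case as well. -/
def IsCompactBetween {n : ℕ} (X : Set (CSpace n → ℂ)) (NX : (CSpace n → ℂ) → ℝ≥0∞)
    (Y : Set (CSpace n → ℂ)) (NY : (CSpace n → ℂ) → ℝ≥0∞)
    (T : (CSpace n → ℂ) → (CSpace n → ℂ)) : Prop :=
  MapsTo T X Y ∧
    ∀ u : ℕ → CSpace n → ℂ, (∀ k, u k ∈ X) → (∃ M : ℝ≥0, ∀ k, NX (u k) ≤ M) →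
      ∃ g ∈ Y, ∃ ψ : ℕ → ℕ, StrictMono ψ ∧
        Tendsto (fun k => NY (T (u (ψ k)) - g)) atTop (𝓝 0)

/-- `lim_{|w| → 1⁻} (1 - |w|²) / (1 - |φ(w)|²) = 0`. -/
def LittleOCondition {n : ℕ} (φ : CSpace n → CSpace n) : Prop :=
  Tendsto (fun w : CSpace n => (1 - ‖w‖ ^ 2) / (1 - ‖φ w‖ ^ 2))
    (comap (fun w : CSpace n => ‖w‖) (𝓝[<] (1 : ℝ))) (𝓝 0)

end

/-!
Both parts rest on one estimate of point evaluations,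
`|F(w)|^p (1 - |w|²)^(q+n) ≤ C ‖F‖_{p,q,s}^p` (`exists_growth_generalHardyNorm`), which contains the
corresponding estimate for Hardy spaces as the case `q = s = 0`. The function `|F|^p` has the
sub-mean value property on discs for every `p > 0`, by Jensen's formula
(`enorm_rpow_le_lintegral_circle`). Averaging over the circles in a complex ellipsoid centred at `w`,
with one semi-axis comparable to `1 - |w|²` and the others to its square root, bounds `|F(w)|^p` by
the mean of `|F|^p` over the ellipsoid (`enorm_rpow_le_lintegral_ball`). Its volume is comparable to
`(1 - |w|²)^(n+1)`, on it `1 - |φ_w|²` is bounded below, and in polar coordinates it lies over an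
interval of radii of length comparable to `1 - |w|²`.

The second ingredient is the bound `∫ |1 - ⟨ξ, z⟩|^(-2n) dσ(ξ) ≤ C (1 - |z|²)^(-n)`
(`exists_lintegral_szego_le`), by a dyadic decomposition and the estimate `σ(Q) ≤ C t^n` for a
nonisotropic ball `Q` of radius `t`.

Put `P = p n / (q + n)`. Part (b) holds since `H^P` embeds boundedly in `H^{p,q,s}`
(`exists_generalHardyNorm_le_hardyNorm`). If `q ≥ 0` then `P ≤ p`, the weight `1 - |φ_a|²` is at most
`1`, and the growth estimate for `H^P` absorbs the factor `|F|^(p-P)`. If `q < 0` then `P > p`, and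
Hölder's inequality leaves the integral of `(1 - |φ_a|²)^n`, which the kernel bound controls.

For part (a), suppose that `(1 - |w_k|²) / (1 - |φ(w_k)|²) ≥ ε` with `|w_k| → 1`. The normalized
kernel powers `u_k` concentrated near `φ(w_k)` are bounded in `H^P` and tend to zero pointwise. A
norm limit of a subsequence of `u_k ∘ φ` is also a pointwise limit, hence zero, and then the growth
estimate at `w_k` gives `((1 - |w_k|²) / (1 - |φ(w_k)|²))^(q+n) → 0`, a contradiction.
-/

/-! ### Sub-mean value property of `|g|^p` -/

lemma log_norm_le_circleAverage {g : ℂ → ℂ} (hg : AnalyticOnNhd ℂ g (Metric.closedBall 0 1))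
    (h0 : g 0 ≠ 0) :
    Real.log ‖g 0‖ ≤ Real.circleAverage (fun z => Real.log ‖g z‖) 0 1 := by
  have hg' : AnalyticOnNhd ℂ g (Metric.closedBall 0 |(1 : ℝ)|) := by simpa using hg
  rw [hg'.circleAverage_log_norm one_ne_zero h0, le_add_iff_nonneg_left]
  refine finsum_nonneg fun u => ?_
  by_cases hu : u ∈ Metric.closedBall (0 : ℂ) |(1 : ℝ)|
  · refine mul_nonneg ?_ ?_
    · have := MeromorphicOn.AnalyticOnNhd.divisor_nonneg hg' u
      exact_mod_cast this
    · rcases eq_or_ne u 0 with rfl | hu0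
      · simp
      · apply Real.log_nonneg
        have : ‖u‖ ≤ 1 := by simpa using hu
        simpa using (one_le_inv₀ (norm_pos_iff.2 hu0)).2 this
  · rw [Function.locallyFinsuppWithin.apply_eq_zero_of_notMem _ hu]; simp

/-- The function `|g|^p` is subharmonic for every `p > 0`. For `p < 1` this is not a case of
convexity of `x ↦ x ^ p`; it follows from Jensen's formula and convexity of the exponential. -/
lemma norm_rpow_le_circleAverage {g : ℂ → ℂ} (hg : AnalyticOnNhd ℂ g (Metric.closedBall 0 1))
    {p : ℝ} (hp : 0 < p) :
    ‖g 0‖ ^ p ≤ Real.circleAverage (fun z => ‖g z‖ ^ p) 0 1 := by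
  rcases eq_or_ne (g 0) 0 with h0 | h0
  · rw [h0, norm_zero, Real.zero_rpow hp.ne']
    exact Real.circleAverage_nonneg_of_nonneg fun z _ => by positivity
  have hc : 0 < ‖g 0‖ := norm_pos_iff.2 h0
  have hsph : Metric.sphere (0 : ℂ) |(1 : ℝ)| ⊆ Metric.closedBall 0 1 := by
    simpa using Metric.sphere_subset_closedBall
  have hgs := hg.mono hsph
  -- `Real.log 0 = 0` would spoil the tangent inequality below at the zeros of `g`, a null set.
  set M : ℝ := Real.log ‖g 0‖ - 1 / p with hM
  set L : ℂ → ℝ := fun z => if g z = 0 then M else Real.log ‖g z‖ with hL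
  have hLeq : (fun z => Real.log ‖g z‖) =ᶠ[codiscreteWithin (Metric.sphere (0 : ℂ) |(1 : ℝ)|)] L := by
    have h1 : g ⁻¹' {0}ᶜ ∈ codiscreteWithin (Metric.closedBall (0 : ℂ) 1) :=
      hg.preimage_zero_mem_codiscreteWithin h0 (by simp)
        ((convex_closedBall (0 : ℂ) 1).isConnected ⟨0, by simp⟩)
    filter_upwards [codiscreteWithin_mono hsph h1] with z hz
    have : g z ≠ 0 := hz
    simp [hL, this]
  have hLint : CircleIntegrable L 0 1 :=
    CircleIntegrable.congr_codiscreteWithin hLeq hgs.meromorphicOn.circleIntegrable_log_norm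
  have hlog : Real.log ‖g 0‖ ≤ Real.circleAverage L 0 1 := by
    rw [← Real.circleAverage_congr_codiscreteWithin hLeq one_ne_zero]
    exact log_norm_le_circleAverage hg h0
  have hcont : CircleIntegrable (fun z => ‖g z‖ ^ p) 0 1 := by
    refine ContinuousOn.circleIntegrable' ?_
    exact (hgs.continuousOn.norm).rpow_const fun x _ => Or.inr hp.le
  have hAint : CircleIntegrable (fun z => (‖g 0‖ ^ p * p) • L z
      + (‖g 0‖ ^ p * (1 - p * Real.log ‖g 0‖))) 0 1 :=
    (hLint.const_smul).add (circleIntegrable_const _ _ _)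
  have hpt : ∀ z, (‖g 0‖ ^ p * p) • L z + (‖g 0‖ ^ p * (1 - p * Real.log ‖g 0‖)) ≤ ‖g z‖ ^ p := by
    intro z
    have hcp : 0 < ‖g 0‖ ^ p := Real.rpow_pos_of_pos hc p
    by_cases hz : g z = 0
    · simp only [hL, hz, if_true, smul_eq_mul, norm_zero, Real.zero_rpow hp.ne', hM]
      apply le_of_eq; field_simp; ring
    · have hz' : 0 < ‖g z‖ := norm_pos_iff.2 hz
      have h1 := Real.add_one_le_exp (p * Real.log ‖g z‖ - p * Real.log ‖g 0‖)
      have h2 : ‖g z‖ ^ p = ‖g 0‖ ^ p * Real.exp (p * Real.log ‖g z‖ - p * Real.log ‖g 0‖) := by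
        rw [Real.rpow_def_of_pos hz', Real.rpow_def_of_pos hc, ← Real.exp_add]; ring_nf
      simp only [hL, hz, if_false, smul_eq_mul]
      rw [h2]
      nlinarith
  have hmono := Real.circleAverage_mono hAint hcont fun z _ => hpt z
  refine le_trans ?_ hmono
  rw [Real.circleAverage_fun_add (f₁ := fun z => (‖g 0‖ ^ p * p) • L z) hLint.const_smul
    (circleIntegrable_const _ _ _),
    Real.circleAverage_fun_smul, Real.circleAverage_const, smul_eq_mul]
  have hcp : 0 < ‖g 0‖ ^ p := Real.rpow_pos_of_pos hc p
  have : ‖g 0‖ ^ p * p * Real.log ‖g 0‖ ≤ ‖g 0‖ ^ p * p * Real.circleAverage L 0 1 := by gcongr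
  nlinarith

lemma enorm_rpow_le_lintegral_circle {g : ℂ → ℂ}
    (hg : AnalyticOnNhd ℂ g (Metric.closedBall 0 1)) {p : ℝ} (hp : 0 < p) :
    ENNReal.ofReal (2 * Real.pi) * ‖g 0‖ₑ ^ p ≤
      ∫⁻ θ in Ioc 0 (2 * Real.pi), ‖g (circleMap 0 1 θ)‖ₑ ^ p := by
  have hsph : Metric.sphere (0 : ℂ) |(1 : ℝ)| ⊆ Metric.closedBall 0 1 := by
    simpa using Metric.sphere_subset_closedBall
  have hcont : CircleIntegrable (fun z => ‖g z‖ ^ p) 0 1 := by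
    refine ContinuousOn.circleIntegrable' ?_
    exact ((hg.mono hsph).continuousOn.norm).rpow_const fun x _ => Or.inr hp.le
  have h := norm_rpow_le_circleAverage hg hp
  have hpi : (0 : ℝ) < 2 * Real.pi := by positivity
  rw [Real.circleAverage_def, smul_eq_mul, ← div_eq_inv_mul, le_div_iff₀ hpi,
    intervalIntegral.integral_of_le hpi.le] at h
  have key : ∀ w : ℂ, ‖w‖ₑ ^ p = ENNReal.ofReal (‖w‖ ^ p) := fun w => by
    rw [← ofReal_norm, ENNReal.ofReal_rpow_of_nonneg (norm_nonneg _) hp.le]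
  simp_rw [key]
  rw [← ofReal_integral_eq_lintegral_ofReal hcont.1 (Eventually.of_forall fun _ => by positivity),
    ← ENNReal.ofReal_mul hpi.le]
  exact ENNReal.ofReal_le_ofReal (by linarith)

/-! ### Anisotropic dilations -/

/-- The complex linear map which multiplies the unit vector `ζ` by `δ` and its orthogonal
complement by `√δ`: the natural dilation near the boundary point `ζ` of the ball. It is written
as a scalar multiple of a rank one perturbation of the identity. -/
noncomputable def anisoDilation {n : ℕ} (ζ : CSpace n) (δ : ℝ) : CSpace n →ₗ[ℂ] CSpace n :=
  ((√δ : ℝ) : ℂ) •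
    LinearMap.transvection (((√δ : ℝ) - 1 : ℂ) • (innerSL ℂ ζ).toLinearMap) ζ

lemma anisoDilation_apply {n : ℕ} (ζ : CSpace n) (δ : ℝ) (v : CSpace n) :
    anisoDilation ζ δ v = ((√δ : ℝ) : ℂ) • (v + (((√δ : ℝ) - 1 : ℂ) * inner ℂ ζ v) • ζ) := by
  simp [anisoDilation, LinearMap.transvection]

lemma abs_det_anisoDilation {n : ℕ} {ζ : CSpace n} (hζ : ‖ζ‖ = 1) {δ : ℝ} (hδ : 0 ≤ δ) :
    |LinearMap.det ((anisoDilation ζ δ).restrictScalars ℝ)| = δ ^ (n + 1) := by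
  rw [LinearMap.det_restrictScalars, Algebra.norm_complex_apply, anisoDilation,
    LinearMap.det_smul, LinearMap.transvection.det]
  have h1 : inner ℂ ζ ζ = 1 := by rw [inner_self_eq_norm_sq_to_K, hζ]; simp
  have hs : (√δ) ^ 2 = δ := Real.sq_sqrt hδ
  simp only [finrank_euclideanSpace, Fintype.card_fin, LinearMap.smul_apply,
    ContinuousLinearMap.coe_coe, innerSL_apply_apply, h1, smul_eq_mul, mul_one, add_sub_cancel,
    ← pow_succ, map_pow, Complex.normSq_ofReal, ← sq, hs]
  exact abs_of_nonneg (by positivity)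

lemma inner_anisoDilation {n : ℕ} {ζ : CSpace n} (hζ : ‖ζ‖ = 1) {δ : ℝ} (hδ : 0 ≤ δ)
    (v : CSpace n) : inner ℂ ζ (anisoDilation ζ δ v) = δ * inner ℂ ζ v := by
  have h1 : inner ℂ ζ ζ = 1 := by rw [inner_self_eq_norm_sq_to_K, hζ]; simp
  have hs : ((√δ : ℝ) : ℂ) * ((√δ : ℝ) : ℂ) = δ := by
    rw [← Complex.ofReal_mul, Real.mul_self_sqrt hδ]
  rw [anisoDilation_apply, inner_smul_right, inner_add_right, inner_smul_right, h1]
  linear_combination inner ℂ ζ v * hs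

/-- Pythagoras for the splitting along `ζ`. -/
lemma norm_sq_smul_add_anisoDilation {n : ℕ} {ζ : CSpace n} (hζ : ‖ζ‖ = 1) {δ : ℝ}
    (hδ : 0 ≤ δ) (c : ℂ) (v : CSpace n) :
    ‖c • ζ + anisoDilation ζ δ v‖ ^ 2 =
      ‖c + δ * inner ℂ ζ v‖ ^ 2 + δ * (‖v‖ ^ 2 - ‖(inner ℂ ζ v : ℂ)‖ ^ 2) := by
  have h1 : inner ℂ ζ ζ = 1 := by rw [inner_self_eq_norm_sq_to_K, hζ]; simp
  set l : ℂ := inner ℂ ζ v with hl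
  set v' : CSpace n := v - l • ζ with hv'
  have horth : inner ℂ ζ v' = 0 := by
    rw [hv', inner_sub_right, inner_smul_right, h1, ← hl]; ring
  have hs : ((√δ : ℝ) : ℂ) * ((√δ : ℝ) : ℂ) = δ := by
    rw [← Complex.ofReal_mul, Real.mul_self_sqrt hδ]
  have pyth : ∀ (x : ℂ) (y : ℂ), ‖x • ζ + y • v'‖ ^ 2 = ‖x‖ ^ 2 + ‖y‖ ^ 2 * ‖v'‖ ^ 2 := by
    intro x y
    have h0 : inner ℂ (x • ζ) (y • v') = 0 := by
      rw [inner_smul_left, inner_smul_right, horth]; ring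
    have := norm_add_sq_eq_norm_sq_add_norm_sq_of_inner_eq_zero _ _ h0
    rw [sq, this, norm_smul, norm_smul, hζ]; ring
  have hv : ‖v‖ ^ 2 = ‖l‖ ^ 2 + ‖v'‖ ^ 2 := by
    have := pyth l 1
    simpa [hv'] using this
  have he : c • ζ + anisoDilation ζ δ v = (c + δ * l) • ζ + ((√δ : ℝ) : ℂ) • v' := by
    rw [anisoDilation_apply, hv', ← hl, ← hs]
    module
  rw [he, pyth, hv, Complex.norm_real, Real.norm_eq_abs, sq_abs, Real.sq_sqrt hδ]
  ring

/-- Change of variables for an anisotropic dilation, which has Jacobian `δ ^ (n + 1)`. -/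
lemma lintegral_comp_anisoDilation {n : ℕ} {ζ : CSpace n} (hζ : ‖ζ‖ = 1) {δ : ℝ} (hδ : 0 < δ)
    (w : CSpace n) {h : CSpace n → ℝ≥0∞} (hh : Measurable h) :
    ENNReal.ofReal (δ ^ (n + 1)) * ∫⁻ v, h (w + anisoDilation ζ δ v) = ∫⁻ x, h x := by
  have hdet := abs_det_anisoDilation hζ hδ.le
  have hpos : 0 < δ ^ (n + 1) := by positivity
  set T := (anisoDilation ζ δ).restrictScalars ℝ with hT
  have hne : LinearMap.det T ≠ 0 := by
    intro h0; rw [h0, abs_zero] at hdet; exact hpos.ne hdet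
  have hTm : Measurable T := (LinearMap.continuous_of_finiteDimensional T).measurable
  have h1 : ∫⁻ v, h (w + anisoDilation ζ δ v) = ∫⁻ y, h (w + y) ∂(Measure.map T volume) := by
    rw [lintegral_map (by fun_prop) hTm]; rfl
  rw [h1, Measure.map_linearMap_addHaar_eq_smul_addHaar volume hne, lintegral_smul_measure,
    abs_inv, hdet, smul_eq_mul, ← mul_assoc, ← ENNReal.ofReal_mul hpos.le,
    mul_inv_cancel₀ hpos.ne', ENNReal.ofReal_one, one_mul, lintegral_add_left_eq_self]

/-! ### Averaging holomorphic functions over ellipsoids -/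

lemma measurable_indicator_unitBall {n : ℕ} {F : CSpace n → ℂ}
    (hF : DifferentiableOn ℂ F (unitBall n)) (p : ℝ) :
    Measurable ((unitBall n).indicator fun x => ‖F x‖ₑ ^ p) := by
  have hm : MeasurableSet (unitBall n) := Metric.isOpen_ball.measurableSet
  have h1 : Measurable ((unitBall n).indicator F) := by
    classical
    rw [← piecewise_eq_indicator]
    exact hF.continuousOn.measurable_piecewise continuousOn_const hm
  have h2 : ((unitBall n).indicator fun x => ‖F x‖ₑ ^ p) =
      (unitBall n).indicator fun x => ‖(unitBall n).indicator F x‖ₑ ^ p := by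
    ext x
    by_cases hx : x ∈ unitBall n <;> simp [hx]
  rw [h2]
  exact (h1.enorm.pow_const p).indicator hm

lemma measurePreserving_circle_smul {n : ℕ} {c : ℂ} (hc : ‖c‖ = 1) :
    MeasurePreserving (fun v : CSpace n => c • v) volume volume := by
  have hc0 : c ≠ 0 := by rintro rfl; simp at hc
  let e : CSpace n ≃ₗᵢ[ℝ] CSpace n :=
    { (LinearEquiv.smulOfNeZero ℂ (CSpace n) c hc0).restrictScalars ℝ with
      norm_map' := fun v => by
        change ‖c • v‖ = ‖v‖
        rw [norm_smul, hc, one_mul] }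
  exact e.measurePreserving

/-- The value of `|F|^p` at `w` is at most its mean over an ellipsoid `w + L (ball 0 c)`, with `L`
complex linear: the ball is a union of circles `{e^{iθ} v}`, on each of which the one-variable
sub-mean value property applies. -/
lemma enorm_rpow_le_lintegral_ball {n : ℕ} {F : CSpace n → ℂ}
    (hF : DifferentiableOn ℂ F (unitBall n)) {p : ℝ} (hp : 0 < p) (w : CSpace n)
    (L : CSpace n →ₗ[ℂ] CSpace n) (c : ℝ)
    (hL : ∀ v ∈ Metric.ball (0 : CSpace n) c, w + L v ∈ unitBall n) :
    volume (Metric.ball (0 : CSpace n) c) * ‖F w‖ₑ ^ p ≤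
      ∫⁻ v in Metric.ball (0 : CSpace n) c,
        (unitBall n).indicator (fun x => ‖F x‖ₑ ^ p) (w + L v) := by
  set Φ : CSpace n → ℝ≥0∞ := (unitBall n).indicator (fun x => ‖F x‖ₑ ^ p) with hΦ
  have hΦm : Measurable Φ := measurable_indicator_unitBall hF p
  have hLc : Continuous L := LinearMap.continuous_of_finiteDimensional L
  set B := Metric.ball (0 : CSpace n) c with hB
  have hBm : MeasurableSet B := Metric.isOpen_ball.measurableSet
  have hunit : ∀ θ : ℝ, ‖circleMap 0 1 θ‖ = 1 := fun θ => by simp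
  have hrot : ∀ θ : ℝ, ∀ v, circleMap 0 1 θ • v ∈ B ↔ v ∈ B := by
    intro θ v
    simp only [hB, Metric.mem_ball, dist_zero_right, norm_smul, hunit, one_mul]
  -- Each slice: the one-variable inequality on the disc through `v`.
  have hslice : ∀ v ∈ B, ENNReal.ofReal (2 * Real.pi) * ‖F w‖ₑ ^ p ≤
      ∫⁻ θ in Ioc 0 (2 * Real.pi), Φ (w + L (circleMap 0 1 θ • v)) := by
    intro v hv
    set g : ℂ → ℂ := fun z => F (w + L (z • v)) with hg
    have hgd : DifferentiableOn ℂ g {z | w + L (z • v) ∈ unitBall n} := by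
      intro z hz
      have h1 : DifferentiableAt ℂ F (w + L (z • v)) :=
        (hF _ hz).differentiableAt (Metric.isOpen_ball.mem_nhds hz)
      have h2 : DifferentiableAt ℂ (fun z : ℂ => w + L (z • v)) z := by
        have : (fun z : ℂ => w + L (z • v)) = fun z => w + z • L v := by
          ext1 z; rw [map_smul]
        rw [this]; fun_prop
      exact (DifferentiableAt.comp z h1 h2).differentiableWithinAt
    have hopen : IsOpen {z : ℂ | w + L (z • v) ∈ unitBall n} :=
      Metric.isOpen_ball.preimage (by fun_prop)
    have hga : AnalyticOnNhd ℂ g (Metric.closedBall 0 1) := by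
      refine (hgd.analyticOnNhd hopen).mono fun z hz => hL _ ?_
      have hz' : ‖z‖ ≤ 1 := by simpa using hz
      have hv' : ‖v‖ < c := by simpa [hB] using hv
      rw [hB, mem_ball_zero_iff, norm_smul]
      nlinarith [norm_nonneg v]
    have hmain := enorm_rpow_le_lintegral_circle hga hp
    have hg0 : g 0 = F w := by simp [hg]
    rw [hg0] at hmain
    refine hmain.trans (le_of_eq ?_)
    refine lintegral_congr fun θ => ?_
    have hmem : w + L (circleMap 0 1 θ • v) ∈ unitBall n := hL _ ((hrot θ v).2 hv)
    rw [hΦ, indicator_of_mem hmem]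
  have hpi : (0 : ℝ) < 2 * Real.pi := by positivity
  have hint := lintegral_mono_ae (μ := volume.restrict B)
    ((ae_restrict_mem hBm).mono fun v hv => hslice v hv)
  rw [lintegral_const, Measure.restrict_apply_univ] at hint
  have hmeas : Measurable fun q : CSpace n × ℝ => Φ (w + L (circleMap 0 1 q.2 • q.1)) := by
    refine hΦm.comp (Continuous.measurable ?_)
    have : Continuous fun q : CSpace n × ℝ => circleMap 0 1 q.2 :=
      (continuous_circleMap 0 1).comp continuous_snd
    fun_prop
  rw [lintegral_lintegral_swap hmeas.aemeasurable] at hint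
  have hinv : ∀ θ : ℝ, ∫⁻ v in B, Φ (w + L (circleMap 0 1 θ • v)) =
      ∫⁻ v in B, Φ (w + L v) := by
    intro θ
    have hmi : Measurable (B.indicator fun v => Φ (w + L v)) :=
      (hΦm.comp (Continuous.measurable (by fun_prop))).indicator hBm
    rw [← lintegral_indicator hBm, ← lintegral_indicator hBm,
      ← (measurePreserving_circle_smul (n := n) (hunit θ)).lintegral_comp hmi]
    refine lintegral_congr fun v => ?_
    by_cases hv : v ∈ B
    · rw [indicator_of_mem hv, indicator_of_mem ((hrot θ v).2 hv)]
    · rw [indicator_of_notMem hv, indicator_of_notMem (fun h => hv ((hrot θ v).1 h))]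
  simp_rw [hinv] at hint
  rw [lintegral_const, Measure.restrict_apply_univ, Real.volume_Ioc, sub_zero,
    mul_comm _ (ENNReal.ofReal (2 * Real.pi)), mul_assoc] at hint
  rw [mul_comm (volume B)]
  exact (ENNReal.mul_le_mul_iff_right (by simpa using hpi) ENNReal.ofReal_ne_top).1 hint

/-! ### Polar coordinates -/

lemma finrank_real_CSpace (n : ℕ) : Module.finrank ℝ (CSpace n) = 2 * n := by
  rw [finrank_real_of_complex, finrank_euclideanSpace, Fintype.card_fin]

lemma lintegral_polar {n : ℕ} {f : CSpace n → ℝ≥0∞} (hn : n ≠ 0) (hf : Measurable f) :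
    ∫⁻ x, f x = ∫⁻ r in Ioi (0 : ℝ), ENNReal.ofReal (r ^ (2 * n - 1)) *
      ∫⁻ ξ : UnitSphere n, f (r • (ξ : CSpace n)) ∂(volume : Measure (CSpace n)).toSphere := by
  have : Nonempty (Fin n) := ⟨⟨0, Nat.pos_of_ne_zero hn⟩⟩
  have : Nontrivial (CSpace n) := inferInstance
  have hm : Measurable fun q : UnitSphere n × ℝ => f (q.2 • (q.1 : CSpace n)) :=
    hf.comp (Continuous.measurable (by fun_prop))
  have hm' : Measurable fun r : ℝ => ∫⁻ ξ : UnitSphere n, f (r • (ξ : CSpace n))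
      ∂(volume : Measure (CSpace n)).toSphere := hm.lintegral_prod_left'
  calc ∫⁻ x, f x = ∫⁻ x : ({0}ᶜ : Set (CSpace n)), f x.1 ∂(volume.comap Subtype.val) := by
        rw [lintegral_subtype_comap (measurableSet_singleton _).compl, restrict_compl_singleton]
    _ = ∫⁻ q : UnitSphere n × Ioi (0 : ℝ), f ((q.2 : ℝ) • (q.1 : CSpace n))
          ∂((volume : Measure (CSpace n)).toSphere.prod (.volumeIoiPow (2 * n - 1))) := by
        rw [← finrank_real_CSpace n,
          ← (volume : Measure (CSpace n)).measurePreserving_homeomorphUnitSphereProd.lintegral_comp_emb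
          (Homeomorph.measurableEmbedding _)]
        refine lintegral_congr fun x => ?_
        have h0 : ‖(x : CSpace n)‖ ≠ 0 := norm_ne_zero_iff.2 x.2
        simp [smul_smul, h0]
    _ = ∫⁻ r : Ioi (0 : ℝ), (∫⁻ ξ : UnitSphere n, f ((r : ℝ) • (ξ : CSpace n))
          ∂(volume : Measure (CSpace n)).toSphere) ∂(.volumeIoiPow (2 * n - 1)) := by
        refine lintegral_prod_symm' _ ?_
        exact hf.comp (Continuous.measurable (by fun_prop))
    _ = _ := by
        rw [Measure.volumeIoiPow]
        refine (lintegral_withDensity_eq_lintegral_mul _ (by fun_prop)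
          (hm'.comp measurable_subtype_coe)).trans ?_
        exact lintegral_subtype_comap measurableSet_Ioi fun r : ℝ =>
          ENNReal.ofReal (r ^ (2 * n - 1)) *
            ∫⁻ ξ : UnitSphere n, f (r • (ξ : CSpace n)) ∂(volume : Measure (CSpace n)).toSphere

/-! ### Growth of functions in general Hardy type spaces -/

lemma one_sub_inner_ne_zero {n : ℕ} {a z : CSpace n} (ha : ‖a‖ < 1) (hz : ‖z‖ ≤ 1) :
    (1 : ℂ) - inner ℂ a z ≠ 0 := by
  intro h
  have h1 : ‖(inner ℂ a z : ℂ)‖ = 1 := by rw [← sub_eq_zero.1 h, norm_one]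
  have h2 := norm_inner_le_norm (𝕜 := ℂ) a z
  nlinarith [norm_nonneg a, norm_nonneg z]

lemma one_sub_norm_sq_ballInvolution {n : ℕ} {a z : CSpace n} (ha : ‖a‖ < 1) (hz : ‖z‖ ≤ 1) :
    1 - ‖ballInvolution a z‖ ^ 2 =
      (1 - ‖a‖ ^ 2) * (1 - ‖z‖ ^ 2) / ‖1 - (inner ℂ a z : ℂ)‖ ^ 2 := by
  have hne := one_sub_inner_ne_zero ha hz
  rcases eq_or_ne a 0 with rfl | ha0
  · simp [ballInvolution, lineProj]
  have hA : 0 < ‖a‖ := norm_pos_iff.2 ha0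
  have hAs : 0 ≤ 1 - ‖a‖ ^ 2 := by nlinarith
  set l : ℂ := inner ℂ a z with hl
  have haa : (inner ℂ a a : ℂ) = ((‖a‖ ^ 2 : ℝ) : ℂ) := by
    rw [inner_self_eq_norm_sq_to_K]; simp
  set k : ℂ := l / ((‖a‖ ^ 2 : ℝ) : ℂ) with hk
  have hP : lineProj a z = k • a := by rw [lineProj, haa]
  set y : CSpace n := z - k • a with hy
  have hA2 : ((‖a‖ ^ 2 : ℝ) : ℂ) ≠ 0 := by
    rw [Complex.ofReal_ne_zero]; positivity
  have horth : inner ℂ a y = 0 := by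
    rw [hy, inner_sub_right, inner_smul_right, haa, ← hl, hk]; field_simp; ring
  have pyth : ∀ (c d : ℂ), ‖c • a + d • y‖ ^ 2 = ‖c‖ ^ 2 * ‖a‖ ^ 2 + ‖d‖ ^ 2 * ‖y‖ ^ 2 := by
    intro c d
    have h0 : inner ℂ (c • a) (d • y) = 0 := by
      rw [inner_smul_left, inner_smul_right, horth]; ring
    have := norm_add_sq_eq_norm_sq_add_norm_sq_of_inner_eq_zero _ _ h0
    rw [sq, this, norm_smul, norm_smul]; ring
  have hz2 : ‖z‖ ^ 2 = ‖k‖ ^ 2 * ‖a‖ ^ 2 + ‖y‖ ^ 2 := by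
    have := pyth k 1
    simpa [hy] using this
  have hnum : a - lineProj a z - ((Real.sqrt (1 - ‖a‖ ^ 2) : ℝ) : ℂ) • (z - lineProj a z) =
      (1 - k) • a + (-((Real.sqrt (1 - ‖a‖ ^ 2) : ℝ) : ℂ)) • y := by
    rw [hP, hy]; module
  have hkl : l = k * ((‖a‖ ^ 2 : ℝ) : ℂ) := by rw [hk]; field_simp
  rw [ballInvolution, norm_smul, hnum, mul_pow, pyth, ← hl, norm_inv, norm_neg, Complex.norm_real,
    Real.norm_eq_abs, sq_abs, Real.sq_sqrt hAs, hz2]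
  have hpos : 0 < ‖1 - l‖ ^ 2 := by
    have := norm_pos_iff.2 hne
    positivity
  have e1 : ‖1 - l‖ ^ 2 = 1 - 2 * (k.re * ‖a‖ ^ 2) + ‖k‖ ^ 2 * (‖a‖ ^ 2) ^ 2 := by
    rw [hkl, Complex.sq_norm, Complex.sq_norm, Complex.normSq_apply, Complex.normSq_apply]
    simp only [Complex.sub_re, Complex.sub_im, Complex.one_re, Complex.one_im,
      Complex.re_mul_ofReal, Complex.im_mul_ofReal]
    ring
  have e2 : ‖1 - k‖ ^ 2 = 1 - 2 * k.re + ‖k‖ ^ 2 := by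
    rw [Complex.sq_norm, Complex.sq_norm, Complex.normSq_apply, Complex.normSq_apply]
    simp only [Complex.sub_re, Complex.sub_im, Complex.one_re, Complex.one_im]
    ring
  rw [eq_div_iff hpos.ne', sub_mul, inv_pow, mul_comm (_⁻¹), mul_assoc,
    inv_mul_cancel₀ hpos.ne', e1, e2]
  ring

lemma one_sub_norm_sq_ballInvolution_nonneg {n : ℕ} {a z : CSpace n} (ha : ‖a‖ < 1)
    (hz : ‖z‖ ≤ 1) : 0 ≤ 1 - ‖ballInvolution a z‖ ^ 2 := by
  rw [one_sub_norm_sq_ballInvolution ha hz]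
  have h1 : 0 ≤ 1 - ‖a‖ ^ 2 := by nlinarith [norm_nonneg a]
  have h2 : 0 ≤ 1 - ‖z‖ ^ 2 := by nlinarith [norm_nonneg z]
  positivity

lemma toSphere_univ_ne_zero {n : ℕ} (hn : n ≠ 0) :
    (volume : Measure (CSpace n)).toSphere univ ≠ 0 := by
  have : Nonempty (Fin n) := ⟨⟨0, Nat.pos_of_ne_zero hn⟩⟩
  have : Nontrivial (CSpace n) := inferInstance
  rw [Ne, Measure.measure_univ_eq_zero]
  exact Measure.toSphere_ne_zero _

lemma toSphere_eq_smul_sphereMeasure {n : ℕ} (hn : n ≠ 0) :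
    (volume : Measure (CSpace n)).toSphere =
      (volume : Measure (CSpace n)).toSphere univ • sphereMeasure n := by
  rw [sphereMeasure, smul_smul,
    ENNReal.mul_inv_cancel (toSphere_univ_ne_zero hn) (measure_ne_top _ _), one_smul]

lemma isProbabilityMeasure_sphereMeasure {n : ℕ} (hn : n ≠ 0) :
    IsProbabilityMeasure (sphereMeasure n) :=
  ⟨by rw [sphereMeasure, Measure.smul_apply, smul_eq_mul,
    ENNReal.inv_mul_cancel (toSphere_univ_ne_zero hn) (measure_ne_top _ _)]⟩

lemma exists_unit_smul_eq {n : ℕ} (hn : n ≠ 0) (w : CSpace n) :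
    ∃ ζ : CSpace n, ‖ζ‖ = 1 ∧ w = (‖w‖ : ℂ) • ζ := by
  rcases eq_or_ne w 0 with rfl | hw
  · refine ⟨EuclideanSpace.single ⟨0, Nat.pos_of_ne_zero hn⟩ 1, by simp, by simp⟩
  · have h : ‖w‖ ≠ 0 := norm_ne_zero_iff.2 hw
    refine ⟨((‖w‖ : ℂ)⁻¹) • w, by simp [norm_smul, h], ?_⟩
    rw [smul_smul, mul_inv_cancel₀ (by exact_mod_cast h), one_smul]

lemma lintegral_le_generalHardyNorm_rpow {n : ℕ} {p : ℝ} (hp : 0 < p) (q s : ℝ)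
    (F : CSpace n → ℂ) {r : ℝ} (hr : r ∈ Ico (0 : ℝ) 1) {a : CSpace n} (ha : a ∈ unitBall n) :
    ENNReal.ofReal ((1 - r ^ 2) ^ q) *
      ∫⁻ ξ : UnitSphere n, ‖F (r • (ξ : CSpace n))‖ₑ ^ p *
        ENNReal.ofReal ((1 - ‖ballInvolution a (r • (ξ : CSpace n))‖ ^ 2) ^ s)
          ∂(sphereMeasure n) ≤ generalHardyNorm p q s F ^ p := by
  rw [← ENNReal.rpow_inv_le_iff hp, ← one_div]
  refine le_trans ?_ (le_iSup₂ (f := fun r (_ : r ∈ Ico (0 : ℝ) 1) =>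
    generalHardyMean p q s r F) r hr)
  exact le_iSup₂ (f := fun a (_ : a ∈ unitBall n) => (ENNReal.ofReal ((1 - r ^ 2) ^ q) *
      ∫⁻ ξ : UnitSphere n, ‖F (r • (ξ : CSpace n))‖ₑ ^ p *
        ENNReal.ofReal ((1 - ‖ballInvolution a (r • (ξ : CSpace n))‖ ^ 2) ^ s)
          ∂(sphereMeasure n)) ^ (1 / p)) a ha

/-- On the ellipsoid at `w` with semi-axes `(1 - ‖w‖²) / 4` and `√(1 - ‖w‖²) / 4`, the quantities
`1 - ‖x‖²` and `1 - ‖w‖²` are comparable and `|1 - ⟨x, w⟩|` is `O(1 - ‖w‖²)`; hence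
`1 - |φ_w(x)|²` is bounded below there. -/
lemma ellipsoid_bounds {n : ℕ} {w ζ v : CSpace n} (hw : ‖w‖ < 1) (hζ : ‖ζ‖ = 1)
    (hwζ : w = (‖w‖ : ℂ) • ζ) (hv : ‖v‖ < 1 / 4) :
    3 / 8 * (1 - ‖w‖ ^ 2) ≤ 1 - ‖w + anisoDilation ζ (1 - ‖w‖ ^ 2) v‖ ^ 2 ∧
    1 - ‖w + anisoDilation ζ (1 - ‖w‖ ^ 2) v‖ ^ 2 ≤ 3 / 2 * (1 - ‖w‖ ^ 2) ∧
    ‖1 - (inner ℂ w (w + anisoDilation ζ (1 - ‖w‖ ^ 2) v) : ℂ)‖ ≤ 5 / 4 * (1 - ‖w‖ ^ 2) := by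
  set ρ := ‖w‖ with hρ
  have hρ0 : 0 ≤ ρ := norm_nonneg w
  set δ := 1 - ρ ^ 2 with hδ
  have hδ0 : 0 < δ := by nlinarith
  have hδ1 : δ ≤ 1 := by nlinarith
  set l : ℂ := inner ℂ ζ v with hl
  have hlv : ‖l‖ ≤ ‖v‖ := by simpa [hζ] using norm_inner_le_norm (𝕜 := ℂ) ζ v
  have hl0 := norm_nonneg l
  have hx : ‖w + anisoDilation ζ δ v‖ ^ 2 = ‖(ρ : ℂ) + δ * l‖ ^ 2 + δ * (‖v‖ ^ 2 - ‖l‖ ^ 2) := by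
    rw [hwζ]; exact norm_sq_smul_add_anisoDilation hζ hδ0.le _ v
  have hdl : ‖(δ : ℂ) * l‖ = δ * ‖l‖ := by
    rw [norm_mul, Complex.norm_real, Real.norm_of_nonneg hδ0.le]
  have hρn : ‖(ρ : ℂ)‖ = ρ := by rw [Complex.norm_real, Real.norm_of_nonneg hρ0]
  have hm1 : ‖(ρ : ℂ) + δ * l‖ ≤ ρ + δ * ‖l‖ := by
    have := norm_add_le (ρ : ℂ) (δ * l)
    rwa [hdl, hρn] at this
  have hm2 : ρ - δ * ‖l‖ ≤ ‖(ρ : ℂ) + δ * l‖ := by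
    have := norm_sub_le_norm_add (ρ : ℂ) (δ * l)
    rwa [hdl, hρn] at this
  have hm0 := norm_nonneg ((ρ : ℂ) + δ * l)
  set m := ‖(ρ : ℂ) + δ * l‖
  have hl4 : δ * ‖l‖ ≤ δ / 4 := by nlinarith
  have hdl0 : 0 ≤ δ * ‖l‖ := by positivity
  refine ⟨?_, ?_, ?_⟩
  · rw [hx]
    have h1 : m ^ 2 ≤ (ρ + δ / 4) ^ 2 := by
      apply pow_le_pow_left₀ hm0; linarith
    have h2 : ‖v‖ ^ 2 - ‖l‖ ^ 2 ≤ 1 / 16 := by nlinarith [norm_nonneg v]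
    have h3 : δ * (‖v‖ ^ 2 - ‖l‖ ^ 2) ≤ δ * (1 / 16) := by gcongr
    nlinarith
  · rw [hx]
    have h2 : 0 ≤ δ * (‖v‖ ^ 2 - ‖l‖ ^ 2) := by
      apply mul_nonneg hδ0.le; nlinarith
    have h3 : ρ ^ 2 - ρ * δ / 2 ≤ m ^ 2 := by
      have h4 : ρ - δ / 4 ≤ m := by linarith
      rcases le_total 0 (ρ - δ / 4) with h | h
      · nlinarith [sq_nonneg δ]
      · nlinarith
    nlinarith
  · have hin : (inner ℂ w (w + anisoDilation ζ δ v) : ℂ) = ρ ^ 2 + ρ * (δ * l) := by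
      have h1 : inner ℂ w w = ((ρ : ℂ)) ^ 2 := by rw [inner_self_eq_norm_sq_to_K]; simp [hρ]
      have h2 : inner ℂ w (anisoDilation ζ δ v) = ρ * (δ * l) := by
        conv_lhs => rw [hwζ]
        rw [inner_smul_left, inner_anisoDilation hζ hδ0.le]; simp [hl]
      rw [inner_add_right, h1, h2]
    have h1 : (1 : ℂ) - (ρ ^ 2 + ρ * (δ * l)) = (δ : ℂ) - ρ * (δ * l) := by
      rw [hδ]; push_cast; ring
    rw [hin, h1]
    refine (norm_sub_le _ _).trans ?_
    rw [norm_mul, hdl, hρn, Complex.norm_real, Real.norm_of_nonneg hδ0.le]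
    have h3 : ρ * (δ * ‖l‖) ≤ 1 * (δ * ‖l‖) := mul_le_mul_of_nonneg_right hw.le hdl0
    linarith

lemma rpow_neg_le_of_comparable {δ t : ℝ} (hδ : 0 < δ) (h1 : 3 / 8 * δ ≤ t) (h2 : t ≤ 3 / 2 * δ)
    (q : ℝ) : t ^ (-q) ≤ (8 / 3) ^ |q| * δ ^ (-q) := by
  have ht : 0 < t := by linarith
  have hu : t = (t / δ) * δ := by field_simp
  have hu1 : 3 / 8 ≤ t / δ := by rwa [le_div_iff₀ hδ]
  have hu2 : t / δ ≤ 8 / 3 := by rw [div_le_iff₀ hδ]; linarith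
  have hu0 : 0 < t / δ := by positivity
  rw [hu, Real.mul_rpow hu0.le hδ.le]
  gcongr
  rcases le_total 0 q with hq | hq
  · rw [abs_of_nonneg hq, Real.rpow_neg hu0.le, ← Real.inv_rpow hu0.le]
    apply Real.rpow_le_rpow (by positivity) _ hq
    rw [inv_le_comm₀ hu0 (by norm_num)]; norm_num; linarith
  · rw [abs_of_nonpos hq]
    exact Real.rpow_le_rpow hu0.le hu2 (by linarith)

/-- Point evaluations are bounded on `H^{p,q,s}`, with the sharp order of growth at the boundary:
the value of `|F|^p` at `w` is at most its mean over an ellipsoid of volume comparable to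
`(1 - ‖w‖²)^(n+1)`, which in polar coordinates lies over an interval of radii of length comparable
to `1 - ‖w‖²`. -/
theorem exists_growth_generalHardyNorm {n : ℕ} (hn : n ≠ 0) {p : ℝ} (hp : 0 < p) (q : ℝ) {s : ℝ}
    (hs : 0 ≤ s) : ∃ C : ℝ≥0, ∀ F : CSpace n → ℂ, DifferentiableOn ℂ F (unitBall n) →
      ∀ w ∈ unitBall n, ‖F w‖ₑ ^ p * ENNReal.ofReal ((1 - ‖w‖ ^ 2) ^ (q + n)) ≤
        C * generalHardyNorm p q s F ^ p := by
  set B := Metric.ball (0 : CSpace n) (1 / 4) with hB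
  have hBm : MeasurableSet B := Metric.isOpen_ball.measurableSet
  have hB0 : volume B ≠ 0 := (Metric.measure_ball_pos volume _ (by norm_num)).ne'
  have hBt : volume B ≠ ∞ := measure_ball_lt_top.ne
  set τ := (volume : Measure (CSpace n)).toSphere univ with hτ
  have hτt : τ ≠ ∞ := measure_ne_top _ _
  set K : ℝ≥0∞ := (volume B)⁻¹ * (τ * ENNReal.ofReal ((25 / 6) ^ s) *
    ENNReal.ofReal ((8 / 3) ^ |q|) * ENNReal.ofReal (3 / 2)) with hK
  have hKt : K ≠ ∞ := by
    simp only [hK, ne_eq, ENNReal.mul_eq_top, ENNReal.inv_eq_top, ENNReal.ofReal_ne_top, hB0, hτt]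
    simp
  refine ⟨K.toNNReal, fun F hF w hw => ?_⟩
  rw [ENNReal.coe_toNNReal hKt]
  have hw1 : ‖w‖ < 1 := by simpa [unitBall] using hw
  obtain ⟨ζ, hζ, hwζ⟩ := exists_unit_smul_eq hn w
  set N := generalHardyNorm p q s F with hN
  set δ := 1 - ‖w‖ ^ 2 with hδ
  have hδ0 : 0 < δ := by nlinarith [norm_nonneg w]
  set Φ : CSpace n → ℝ≥0∞ := (unitBall n).indicator (fun x => ‖F x‖ₑ ^ p) with hΦ
  have hΦm : Measurable Φ := measurable_indicator_unitBall hF p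
  set D : Set (CSpace n) := {x | 3 / 8 * δ ≤ 1 - ‖x‖ ^ 2 ∧ 1 - ‖x‖ ^ 2 ≤ 3 / 2 * δ ∧
    ‖1 - (inner ℂ w x : ℂ)‖ ≤ 5 / 4 * δ} with hD
  have hDm : MeasurableSet D := by
    have c1 : Continuous fun x : CSpace n => 1 - ‖x‖ ^ 2 := by fun_prop
    have c2 : Continuous fun x : CSpace n => ‖1 - (inner ℂ w x : ℂ)‖ := by fun_prop
    exact ((isClosed_le continuous_const c1).inter ((isClosed_le c1 continuous_const).inter
      (isClosed_le c2 continuous_const))).measurableSet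
  set h : CSpace n → ℝ≥0∞ := D.indicator Φ with hh
  have hhm : Measurable h := hΦm.indicator hDm
  have hDB : ∀ x ∈ D, x ∈ unitBall n := by
    intro x hx
    have := hx.1
    have h2 : ‖x‖ < 1 := by nlinarith [norm_nonneg x]
    simpa [unitBall] using h2
  have hmem : ∀ v ∈ B, w + anisoDilation ζ δ v ∈ D := fun v hv =>
    ellipsoid_bounds hw1 hζ hwζ (by simpa [hB] using hv)
  -- Mean value over the ellipsoid, and change of variables.
  have step1 : ENNReal.ofReal (δ ^ (n + 1)) * (volume B * ‖F w‖ₑ ^ p) ≤ ∫⁻ x, h x := by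
    rw [← lintegral_comp_anisoDilation hζ hδ0 w hhm]
    gcongr
    refine (enorm_rpow_le_lintegral_ball hF hp w (anisoDilation ζ δ) (1 / 4)
      fun v hv => hDB _ (hmem v hv)).trans ?_
    rw [← lintegral_indicator hBm]
    refine lintegral_mono fun v => ?_
    by_cases hv : v ∈ B
    · rw [indicator_of_mem hv, hh, indicator_of_mem (hmem v hv)]
    · rw [indicator_of_notMem hv]; exact zero_le
  -- Integral over each sphere.
  set M : ℝ≥0∞ := τ * ENNReal.ofReal ((25 / 6) ^ s) *
    ENNReal.ofReal ((8 / 3) ^ |q|) * ENNReal.ofReal (δ ^ (-q)) * N ^ p with hM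
  have step2 : ∀ r ∈ Ioi (0 : ℝ), ENNReal.ofReal (r ^ (2 * n - 1)) *
      ∫⁻ ξ : UnitSphere n, h (r • (ξ : CSpace n)) ∂(volume : Measure (CSpace n)).toSphere ≤
      (Icc (1 - 3 / 2 * δ) 1).indicator (fun _ => M) r := by
    intro r hr
    have hr0 : (0 : ℝ) < r := hr
    have hnorm : ∀ ξ : UnitSphere n, ‖r • (ξ : CSpace n)‖ = r := fun ξ => by
      rw [norm_smul, norm_eq_of_mem_sphere ξ, mul_one, Real.norm_of_nonneg hr0.le]
    by_cases hrD : 3 / 8 * δ ≤ 1 - r ^ 2 ∧ 1 - r ^ 2 ≤ 3 / 2 * δ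
    · have hr1 : r < 1 := by nlinarith [hrD.1]
      have hrI : r ∈ Icc (1 - 3 / 2 * δ) 1 := ⟨by nlinarith [hrD.2], hr1.le⟩
      rw [indicator_of_mem hrI]
      have hle1 : ENNReal.ofReal (r ^ (2 * n - 1)) ≤ 1 := by
        rw [← ENNReal.ofReal_one]
        exact ENNReal.ofReal_le_ofReal (pow_le_one₀ hr0.le hr1.le)
      have hpt : ∀ ξ : UnitSphere n, h (r • (ξ : CSpace n)) ≤ ENNReal.ofReal ((25 / 6) ^ s) *
          (‖F (r • (ξ : CSpace n))‖ₑ ^ p *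
            ENNReal.ofReal ((1 - ‖ballInvolution w (r • (ξ : CSpace n))‖ ^ 2) ^ s)) := by
        intro ξ
        by_cases hx : r • (ξ : CSpace n) ∈ D
        · rw [hh, indicator_of_mem hx, hΦ, indicator_of_mem (hDB _ hx), mul_left_comm,
            ← ENNReal.ofReal_mul (by positivity)]
          have hxle : ‖r • (ξ : CSpace n)‖ ≤ 1 := by rw [hnorm]; exact hr1.le
          have hpos := norm_pos_iff.2 (one_sub_inner_ne_zero hw1 hxle)
          -- `(1 - ‖w‖²) (1 - ‖x‖²) / |1 - ⟨x, w⟩|² ≥ (δ · 3 δ / 8) / (5 δ / 4)² = 6 / 25` on `D`.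
          have h6 : 6 / 25 ≤ 1 - ‖ballInvolution w (r • (ξ : CSpace n))‖ ^ 2 := by
            rw [one_sub_norm_sq_ballInvolution hw1 hxle, le_div_iff₀ (by positivity)]
            have h1 : ‖1 - (inner ℂ w (r • (ξ : CSpace n)) : ℂ)‖ ^ 2 ≤ (5 / 4 * δ) ^ 2 :=
              pow_le_pow_left₀ hpos.le hx.2.2 2
            have h2 := hx.1
            rw [← hδ]
            nlinarith
          have h7 : (1 : ℝ) ≤ (25 / 6) ^ s *
              (1 - ‖ballInvolution w (r • (ξ : CSpace n))‖ ^ 2) ^ s := by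
            rw [← Real.mul_rpow (by norm_num) (by linarith)]
            exact Real.one_le_rpow (by linarith) hs
          calc ‖F (r • (ξ : CSpace n))‖ₑ ^ p = ‖F (r • (ξ : CSpace n))‖ₑ ^ p * 1 := (mul_one _).symm
            _ ≤ _ := by
              gcongr
              rw [← ENNReal.ofReal_one]
              exact ENNReal.ofReal_le_ofReal h7
        · rw [hh, indicator_of_notMem hx]; exact zero_le
      have hqpos : 0 < 1 - r ^ 2 := by nlinarith
      have hnormle := lintegral_le_generalHardyNorm_rpow hp q s F ⟨hr0.le, hr1⟩ hw
      have hI : ∫⁻ ξ : UnitSphere n, ‖F (r • (ξ : CSpace n))‖ₑ ^ p *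
          ENNReal.ofReal ((1 - ‖ballInvolution w (r • (ξ : CSpace n))‖ ^ 2) ^ s)
            ∂(sphereMeasure n) ≤
          ENNReal.ofReal ((8 / 3) ^ |q|) * ENNReal.ofReal (δ ^ (-q)) * N ^ p := by
        have h8 := rpow_neg_le_of_comparable hδ0 hrD.1 hrD.2 q
        have h9 : ENNReal.ofReal ((1 - r ^ 2) ^ (-q)) * ENNReal.ofReal ((1 - r ^ 2) ^ q) = 1 := by
          rw [← ENNReal.ofReal_mul (by positivity), ← Real.rpow_add hqpos, neg_add_cancel,
            Real.rpow_zero, ENNReal.ofReal_one]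
        rw [← ENNReal.ofReal_mul (by positivity)]
        refine le_trans ?_ (mul_le_mul' (ENNReal.ofReal_le_ofReal h8) hnormle)
        rw [← mul_assoc, h9, one_mul]
      calc _ ≤ 1 * ∫⁻ ξ : UnitSphere n, ENNReal.ofReal ((25 / 6) ^ s) *
          (‖F (r • (ξ : CSpace n))‖ₑ ^ p *
            ENNReal.ofReal ((1 - ‖ballInvolution w (r • (ξ : CSpace n))‖ ^ 2) ^ s))
            ∂(volume : Measure (CSpace n)).toSphere :=
            mul_le_mul' hle1 (lintegral_mono hpt)
        _ = τ * (ENNReal.ofReal ((25 / 6) ^ s) * ∫⁻ ξ : UnitSphere n,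
          (‖F (r • (ξ : CSpace n))‖ₑ ^ p *
            ENNReal.ofReal ((1 - ‖ballInvolution w (r • (ξ : CSpace n))‖ ^ 2) ^ s))
            ∂(sphereMeasure n)) := by
            rw [toSphere_eq_smul_sphereMeasure hn, lintegral_smul_measure, one_mul,
              lintegral_const_mul' _ _ ENNReal.ofReal_ne_top, smul_eq_mul]
        _ ≤ τ * (ENNReal.ofReal ((25 / 6) ^ s) *
            (ENNReal.ofReal ((8 / 3) ^ |q|) * ENNReal.ofReal (δ ^ (-q)) * N ^ p)) := by gcongr
        _ = M := by rw [hM]; ring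
    · have hz : ∀ ξ : UnitSphere n, h (r • (ξ : CSpace n)) = 0 := by
        intro ξ
        refine indicator_of_notMem (fun hx => hrD ?_) _
        have h1 := hx.1
        have h2 := hx.2.1
        rw [hnorm] at h1 h2
        exact ⟨h1, h2⟩
      simp [hz]
  have step3 : ∫⁻ x, h x ≤ M * ENNReal.ofReal (3 / 2 * δ) := by
    rw [lintegral_polar hn hhm]
    refine (setLIntegral_mono' measurableSet_Ioi step2).trans ?_
    refine (setLIntegral_le_lintegral _ _).trans ?_
    rw [lintegral_indicator_const measurableSet_Icc, Real.volume_Icc]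
    gcongr
    linarith
  have step4 := step1.trans step3
  have e1 : ENNReal.ofReal (δ ^ (q + n)) =
      ENNReal.ofReal (δ ^ (q - 1)) * ENNReal.ofReal (δ ^ (n + 1)) := by
    rw [← ENNReal.ofReal_mul (by positivity), ← Real.rpow_natCast, ← Real.rpow_add hδ0]
    congr 2; push_cast; ring
  have e2 : ENNReal.ofReal (δ ^ (q - 1)) * (ENNReal.ofReal (δ ^ (-q)) *
      ENNReal.ofReal (3 / 2 * δ)) = ENNReal.ofReal (3 / 2) := by
    rw [← ENNReal.ofReal_mul (by positivity), ← ENNReal.ofReal_mul (by positivity)]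
    congr 1
    have : δ ^ (q - 1) * (δ ^ (-q) * (3 / 2 * δ)) =
        (δ ^ (q - 1) * δ ^ (-q) * δ ^ (1 : ℝ)) * (3 / 2) := by rw [Real.rpow_one]; ring
    rw [this, ← Real.rpow_add hδ0, ← Real.rpow_add hδ0,
      show q - 1 + -q + 1 = 0 by ring, Real.rpow_zero, one_mul]
  calc ‖F w‖ₑ ^ p * ENNReal.ofReal (δ ^ (q + n))
      = (volume B)⁻¹ * (ENNReal.ofReal (δ ^ (q - 1)) *
          (ENNReal.ofReal (δ ^ (n + 1)) * (volume B * ‖F w‖ₑ ^ p))) := by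
        rw [e1]
        calc _ = 1 * (‖F w‖ₑ ^ p * (ENNReal.ofReal (δ ^ (q - 1)) *
              ENNReal.ofReal (δ ^ (n + 1)))) := (one_mul _).symm
          _ = _ := by rw [← ENNReal.inv_mul_cancel hB0 hBt]; ring
    _ ≤ (volume B)⁻¹ * (ENNReal.ofReal (δ ^ (q - 1)) * (M * ENNReal.ofReal (3 / 2 * δ))) := by
        gcongr
    _ = K * N ^ p := by
        rw [hK, ← e2, hM]; ring

/-! ### Integrals of the Poisson-Szegő kernel -/

lemma one_sub_norm_le_norm_one_sub_inner {n : ℕ} (z : CSpace n) (ξ : UnitSphere n) :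
    1 - ‖z‖ ≤ ‖1 - (inner ℂ z (ξ : CSpace n) : ℂ)‖ := by
  have h1 := norm_inner_le_norm (𝕜 := ℂ) z (ξ : CSpace n)
  rw [norm_eq_of_mem_sphere ξ, mul_one] at h1
  have h2 := norm_sub_norm_le (1 : ℂ) (inner ℂ z (ξ : CSpace n))
  rw [norm_one] at h2
  linarith

/-- The volume of the part of the unit ball at nonisotropic distance at most `2 t` from `ζ` is
`O(t ^ (n + 1))`: this set lies in a dilated ball. -/
lemma volume_nonisotropic_le {n : ℕ} {ζ : CSpace n} (hζ : ‖ζ‖ = 1) {t : ℝ} (ht : 0 < t) :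
    volume {x : CSpace n | ‖1 - (inner ℂ ζ x : ℂ)‖ ≤ 2 * t ∧ ‖x‖ ≤ 1} ≤
      ENNReal.ofReal (t ^ (n + 1)) * volume (Metric.ball (0 : CSpace n) 4) := by
  set D := {x : CSpace n | ‖1 - (inner ℂ ζ x : ℂ)‖ ≤ 2 * t ∧ ‖x‖ ≤ 1} with hD
  have hDm : MeasurableSet D := by
    have c1 : Continuous fun x : CSpace n => ‖1 - (inner ℂ ζ x : ℂ)‖ := by fun_prop
    exact ((isClosed_le c1 continuous_const).inter
      (isClosed_le continuous_norm continuous_const)).measurableSet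
  have hBm : MeasurableSet (Metric.ball (0 : CSpace n) 4) := Metric.isOpen_ball.measurableSet
  rw [← lintegral_indicator_one hDm,
    ← lintegral_comp_anisoDilation hζ ht ζ (measurable_one.indicator hDm),
    ← lintegral_indicator_one hBm]
  gcongr with v
  by_cases hv : ζ + anisoDilation ζ t v ∈ D
  · have hvB : v ∈ Metric.ball (0 : CSpace n) 4 := by
      have h1 : inner ℂ ζ ζ = (1 : ℂ) := by rw [inner_self_eq_norm_sq_to_K, hζ]; simp
      set l : ℂ := inner ℂ ζ v with hl
      have hl2 : t * ‖l‖ ≤ 2 * t := by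
        have := hv.1
        rwa [inner_add_right, h1, inner_anisoDilation hζ ht.le, sub_add_cancel_left, norm_neg,
          norm_mul, Complex.norm_real, Real.norm_of_nonneg ht.le] at this
      have hl3 : ‖l‖ ≤ 2 := by nlinarith
      have hx := norm_sq_smul_add_anisoDilation hζ ht.le 1 v
      rw [one_smul, ← hl] at hx
      have hx1 : ‖ζ + anisoDilation ζ t v‖ ^ 2 ≤ 1 := pow_le_one₀ (norm_nonneg _) hv.2
      have hm : 1 - t * ‖l‖ ≤ ‖1 + (t : ℂ) * l‖ := by
        have := norm_sub_le_norm_add (1 : ℂ) (t * l)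
        rwa [norm_one, norm_mul, Complex.norm_real, Real.norm_of_nonneg ht.le] at this
      have hm2 : 1 - 2 * (t * ‖l‖) ≤ ‖1 + (t : ℂ) * l‖ ^ 2 := by
        nlinarith [sq_nonneg (‖1 + (t : ℂ) * l‖ - 1)]
      have hfin : t * (‖v‖ ^ 2 - ‖l‖ ^ 2) ≤ t * 4 := by linarith
      have hfin2 := le_of_mul_le_mul_left hfin ht
      rw [mem_ball_zero_iff]
      nlinarith [norm_nonneg v, norm_nonneg l]
    rw [indicator_of_mem hvB, indicator_of_mem hv]; simp
  · rw [indicator_of_notMem hv]; exact zero_le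

/-- Nonisotropic balls of radius `t` on the sphere have measure `O(t ^ n)`. -/
lemma exists_sphereMeasure_nonisotropic_le {n : ℕ} (hn : n ≠ 0) :
    ∃ C : ℝ≥0, ∀ z : CSpace n, ‖z‖ < 1 → ∀ t : ℝ, 1 - ‖z‖ ≤ t →
      sphereMeasure n {ξ : UnitSphere n | ‖1 - (inner ℂ z (ξ : CSpace n) : ℂ)‖ < t} ≤
        C * ENNReal.ofReal (t ^ n) := by
  have := isProbabilityMeasure_sphereMeasure hn
  set τ := (volume : Measure (CSpace n)).toSphere univ with hτ
  have hτ0 : τ ≠ 0 := toSphere_univ_ne_zero hn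
  have hVt : volume (Metric.ball (0 : CSpace n) 4) ≠ ∞ := measure_ball_lt_top.ne
  set K : ℝ≥0∞ := τ⁻¹ * (ENNReal.ofReal (2 * 2 ^ (2 * n - 1)) *
    volume (Metric.ball (0 : CSpace n) 4)) with hK
  have hKt : K ≠ ∞ := ENNReal.mul_ne_top (ENNReal.inv_ne_top.2 hτ0)
    (ENNReal.mul_ne_top ENNReal.ofReal_ne_top hVt)
  refine ⟨1 + K.toNNReal, fun z hz t ht => ?_⟩
  have ht0 : 0 < t := by linarith
  rw [ENNReal.coe_add, ENNReal.coe_one, ENNReal.coe_toNNReal hKt]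
  -- The term `1` in the constant covers `t ≥ 1`; otherwise the radii used below are at least `1 / 2`.
  rcases le_total 1 t with ht1 | ht1
  · refine prob_le_one.trans ?_
    rw [add_mul, one_mul]
    refine le_add_right ?_
    rw [← ENNReal.ofReal_one]
    exact ENNReal.ofReal_le_ofReal (one_le_pow₀ ht1)
  obtain ⟨ζ, hζ, hzζ⟩ := exists_unit_smul_eq hn z
  set A := {ξ : UnitSphere n | ‖1 - (inner ℂ z (ξ : CSpace n) : ℂ)‖ < t} with hA
  have hAm : MeasurableSet A := by
    have c1 : Continuous fun ξ : UnitSphere n => ‖1 - (inner ℂ z (ξ : CSpace n) : ℂ)‖ := by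
      fun_prop
    exact (isOpen_lt c1 continuous_const).measurableSet
  set D := {x : CSpace n | ‖1 - (inner ℂ ζ x : ℂ)‖ ≤ 2 * t ∧ ‖x‖ ≤ 1} with hD
  have hDm : MeasurableSet D := by
    have c1 : Continuous fun x : CSpace n => ‖1 - (inner ℂ ζ x : ℂ)‖ := by fun_prop
    exact ((isClosed_le c1 continuous_const).inter
      (isClosed_le continuous_norm continuous_const)).measurableSet
  have hvol := volume_nonisotropic_le (n := n) hζ ht0
  rw [← hD] at hvol
  -- The part of the cone over `A` with radii in `[1 - t / 2, 1]` lies in `D`.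
  have hAD : ∀ r ∈ Icc (1 - t / 2) 1, ∀ ξ ∈ A, r • (ξ : CSpace n) ∈ D := by
    intro r hr ξ hξ
    have hr0 : 0 ≤ r := by linarith [hr.1]
    have hξ1 : ‖(ξ : CSpace n)‖ = 1 := norm_eq_of_mem_sphere ξ
    have hin : (inner ℂ z (ξ : CSpace n) : ℂ) = ‖z‖ * inner ℂ ζ (ξ : CSpace n) := by
      conv_lhs => rw [hzζ]
      rw [inner_smul_left]; simp
    have hin2 : (inner ℂ ζ (r • (ξ : CSpace n)) : ℂ) = r * inner ℂ ζ (ξ : CSpace n) := by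
      rw [← Complex.coe_smul, inner_smul_right]
    have hξA : ‖1 - (inner ℂ z (ξ : CSpace n) : ℂ)‖ < t := hξ
    rw [hin] at hξA
    set m : ℂ := inner ℂ ζ (ξ : CSpace n) with hm
    have hm1 : ‖m‖ ≤ 1 := by
      have := norm_inner_le_norm (𝕜 := ℂ) ζ (ξ : CSpace n)
      rwa [hζ, hξ1, mul_one] at this
    refine ⟨?_, ?_⟩
    · rw [hin2]
      have e : (1 : ℂ) - r * m = (1 - ‖z‖ * m) + ((‖z‖ - r : ℝ) : ℂ) * m := by push_cast; ring
      rw [e]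
      refine (norm_add_le _ _).trans ?_
      rw [norm_mul, Complex.norm_real, Real.norm_eq_abs]
      have h1 : |‖z‖ - r| ≤ t := by rw [abs_le]; constructor <;> linarith [hr.1, hr.2]
      nlinarith [abs_nonneg (‖z‖ - r), norm_nonneg m]
    · rw [norm_smul, hξ1, mul_one, Real.norm_of_nonneg hr0]; exact hr.2
  have hlow : ENNReal.ofReal (t / 2) * (ENNReal.ofReal ((1 / 2) ^ (2 * n - 1)) *
      (volume : Measure (CSpace n)).toSphere A) ≤ volume D := by
    rw [← lintegral_indicator_one hDm, lintegral_polar hn (measurable_one.indicator hDm)]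
    have hsub : Icc (1 - t / 2) 1 ⊆ Ioi (0 : ℝ) := fun r hr => by
      have := hr.1
      simp only [mem_Ioi]; linarith
    refine le_trans ?_ (lintegral_mono_set hsub)
    have hconst : ENNReal.ofReal (t / 2) * (ENNReal.ofReal ((1 / 2) ^ (2 * n - 1)) *
        (volume : Measure (CSpace n)).toSphere A) = ∫⁻ _ in Icc (1 - t / 2) 1,
          (ENNReal.ofReal ((1 / 2) ^ (2 * n - 1)) *
            (volume : Measure (CSpace n)).toSphere A) := by
      rw [setLIntegral_const, Real.volume_Icc, mul_comm]
      congr 2; ring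
    rw [hconst]
    refine setLIntegral_mono' measurableSet_Icc fun r hr => ?_
    gcongr ?_ * ?_
    · apply ENNReal.ofReal_le_ofReal
      gcongr
      linarith [hr.1]
    · rw [← lintegral_indicator_one hAm]
      refine lintegral_mono fun ξ => ?_
      by_cases hξ : ξ ∈ A
      · rw [indicator_of_mem hξ, indicator_of_mem (hAD r hr ξ hξ)]; simp
      · rw [indicator_of_notMem hξ]; exact zero_le
  have hfin := hlow.trans hvol
  have hmain : sphereMeasure n A ≤ K * ENNReal.ofReal (t ^ n) := by
    rw [sphereMeasure, Measure.smul_apply, smul_eq_mul, hK, mul_assoc, ← hτ]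
    gcongr
    calc (volume : Measure (CSpace n)).toSphere A
        = ENNReal.ofReal (2 / t * 2 ^ (2 * n - 1)) * (ENNReal.ofReal (t / 2) *
          (ENNReal.ofReal ((1 / 2) ^ (2 * n - 1)) *
            (volume : Measure (CSpace n)).toSphere A)) := by
          rw [← mul_assoc, ← mul_assoc, ← ENNReal.ofReal_mul (by positivity),
            ← ENNReal.ofReal_mul (by positivity)]
          have : 2 / t * 2 ^ (2 * n - 1) * (t / 2) * (1 / 2) ^ (2 * n - 1) = 1 := by
            rw [one_div, inv_pow]; field_simp
          rw [this, ENNReal.ofReal_one, one_mul]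
      _ ≤ ENNReal.ofReal (2 / t * 2 ^ (2 * n - 1)) * (ENNReal.ofReal (t ^ (n + 1)) *
          volume (Metric.ball (0 : CSpace n) 4)) := by gcongr
      _ = _ := by
          rw [← mul_assoc, ← ENNReal.ofReal_mul (by positivity),
            mul_right_comm (ENNReal.ofReal _), ← ENNReal.ofReal_mul (by positivity)]
          congr 2; field_simp; ring
  refine hmain.trans ?_
  gcongr
  exact le_add_self

/-- The integral of `|1 - ⟨ξ, z⟩|^(-2n)` over the sphere is `O((1 - |z|²)^(-n))`. The sphere is cut
into the dyadic shells `2^k (1 - |z|) ≤ |1 - ⟨ξ, z⟩| < 2^(k+1) (1 - |z|)`. -/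
theorem exists_lintegral_szego_le {n : ℕ} (hn : n ≠ 0) :
    ∃ C : ℝ≥0, ∀ z : CSpace n, ‖z‖ < 1 →
      ∫⁻ ξ : UnitSphere n, ENNReal.ofReal
        ((‖1 - (inner ℂ z (ξ : CSpace n) : ℂ)‖ ^ (2 * n))⁻¹) ∂(sphereMeasure n) ≤
        C * ENNReal.ofReal (((1 - ‖z‖ ^ 2) ^ n)⁻¹) := by
  obtain ⟨C, hC⟩ := exists_sphereMeasure_nonisotropic_le hn
  refine ⟨C * (2 ^ n * 2 ^ n * 2), fun z hz => ?_⟩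
  set δ := 1 - ‖z‖ with hδ
  have hδ0 : 0 < δ := by linarith
  set y : UnitSphere n → ℝ := fun ξ => ‖1 - (inner ℂ z (ξ : CSpace n) : ℂ)‖ with hy
  have hyδ : ∀ ξ, δ ≤ y ξ := fun ξ => one_sub_norm_le_norm_one_sub_inner z ξ
  have hyc : Continuous y := by fun_prop
  set A : ℕ → Set (UnitSphere n) := fun k => {ξ | y ξ < 2 ^ (k + 1) * δ} with hA
  have hAm : ∀ k, MeasurableSet (A k) := fun k =>
    (isOpen_lt hyc continuous_const).measurableSet
  have hpt : ∀ ξ, ENNReal.ofReal ((y ξ ^ (2 * n))⁻¹) ≤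
      ∑' k, (A k).indicator (fun _ => ENNReal.ofReal (((2 ^ k * δ) ^ (2 * n))⁻¹)) ξ := by
    intro ξ
    obtain ⟨k, hk1, hk2⟩ := exists_nat_pow_near (x := y ξ / δ) (y := 2)
      ((one_le_div hδ0).2 (hyδ ξ)) one_lt_two
    rw [le_div_iff₀ hδ0] at hk1
    rw [div_lt_iff₀ hδ0] at hk2
    refine le_trans ?_ (ENNReal.le_tsum k)
    rw [indicator_of_mem (show ξ ∈ A k from hk2)]
    apply ENNReal.ofReal_le_ofReal
    have : 0 < 2 ^ k * δ := by positivity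
    gcongr
  have hterm : ∀ k : ℕ, ENNReal.ofReal (((2 ^ k * δ) ^ (2 * n))⁻¹) *
      (C * ENNReal.ofReal ((2 ^ (k + 1) * δ) ^ n)) ≤
      C * ENNReal.ofReal (2 ^ n * (δ ^ n)⁻¹) * (2⁻¹) ^ k := by
    intro k
    rw [mul_left_comm, mul_assoc, ← ENNReal.ofReal_mul (by positivity)]
    have h2 : ((2 : ℝ≥0∞)⁻¹) ^ k = ENNReal.ofReal ((1 / 2) ^ k) := by
      rw [ENNReal.ofReal_pow (by norm_num), one_div, ENNReal.ofReal_inv_of_pos (by norm_num)]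
      simp
    rw [h2, ← ENNReal.ofReal_mul (by positivity)]
    refine mul_le_mul_right (ENNReal.ofReal_le_ofReal ?_) _
    have e : ((2 ^ k * δ) ^ (2 * n))⁻¹ * (2 ^ (k + 1) * δ) ^ n =
        2 ^ n * (δ ^ n)⁻¹ * ((1 / 2) ^ k) ^ n := by
      rw [pow_succ, two_mul, pow_add, one_div, inv_pow, inv_pow, mul_pow, mul_pow, mul_pow]
      field_simp
    rw [e]
    gcongr
    exact pow_le_of_le_one (by positivity) (pow_le_one₀ (by norm_num) (by norm_num)) hn
  calc ∫⁻ ξ : UnitSphere n, ENNReal.ofReal ((y ξ ^ (2 * n))⁻¹) ∂(sphereMeasure n)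
      ≤ ∫⁻ ξ : UnitSphere n, ∑' k, (A k).indicator
          (fun _ => ENNReal.ofReal (((2 ^ k * δ) ^ (2 * n))⁻¹)) ξ ∂(sphereMeasure n) :=
        lintegral_mono hpt
    _ = ∑' k, ENNReal.ofReal (((2 ^ k * δ) ^ (2 * n))⁻¹) * sphereMeasure n (A k) := by
        rw [lintegral_tsum fun k => (measurable_const.indicator (hAm k)).aemeasurable]
        congr 1; ext1 k
        rw [lintegral_indicator_const (hAm k)]
    _ ≤ ∑' k : ℕ, C * ENNReal.ofReal (2 ^ n * (δ ^ n)⁻¹) * (2⁻¹) ^ k := by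
        refine ENNReal.tsum_le_tsum fun k => le_trans ?_ (hterm k)
        gcongr
        refine hC z hz _ ?_
        have : (1 : ℝ) ≤ 2 ^ (k + 1) := one_le_pow₀ one_le_two
        nlinarith
    _ = C * ENNReal.ofReal (2 ^ n * (δ ^ n)⁻¹) * 2 := by
        rw [ENNReal.tsum_mul_left, ENNReal.tsum_geometric, ENNReal.one_sub_inv_two, inv_inv]
    _ ≤ C * ENNReal.ofReal (2 ^ n * (2 ^ n * ((1 - ‖z‖ ^ 2) ^ n)⁻¹)) * 2 := by
        have h1 : 0 < 1 - ‖z‖ ^ 2 := by nlinarith [norm_nonneg z]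
        gcongr
        rw [← div_eq_mul_inv, ← div_pow, ← inv_pow]
        gcongr
        rw [inv_eq_one_div, div_le_div_iff₀ hδ0 h1]
        nlinarith [norm_nonneg z]
    _ = _ := by
        rw [← mul_assoc (2 ^ n : ℝ), ENNReal.ofReal_mul (by positivity),
          ENNReal.ofReal_mul (by positivity), ENNReal.ofReal_pow (by norm_num)]
        push_cast
        simp only [ENNReal.ofReal_ofNat]
        ring

/-! ### Embedding of Hardy spaces in general Hardy type spaces -/

lemma hardyNorm_eq_generalHardyNorm {n : ℕ} (P : ℝ) (F : CSpace n → ℂ) :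
    hardyNorm P F = generalHardyNorm P 0 0 F := by
  have h0 : (0 : CSpace n) ∈ unitBall n := by simp [unitBall]
  have hne : ∃ a : CSpace n, a ∈ unitBall n := ⟨0, h0⟩
  simp only [hardyNorm, generalHardyNorm, generalHardyMean, Real.rpow_zero, ENNReal.ofReal_one,
    one_mul, mul_one]
  refine iSup_congr fun r => iSup_congr fun _ => ?_
  exact (biSup_const hne).symm

lemma lintegral_le_hardyNorm_rpow {n : ℕ} {P : ℝ} (hP : 0 < P) (F : CSpace n → ℂ) {r : ℝ}
    (hr : r ∈ Ico (0 : ℝ) 1) :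
    ∫⁻ ξ : UnitSphere n, ‖F (r • (ξ : CSpace n))‖ₑ ^ P ∂(sphereMeasure n) ≤ hardyNorm P F ^ P := by
  have h := lintegral_le_generalHardyNorm_rpow (n := n) hP 0 0 F hr
    (a := 0) (by simp [unitBall])
  rw [hardyNorm_eq_generalHardyNorm]
  simpa using h

lemma generalHardyNorm_le_of_forall {n : ℕ} {p q s : ℝ} (hp : 0 < p) {F : CSpace n → ℂ}
    {C N : ℝ≥0∞} (h : ∀ r ∈ Ico (0 : ℝ) 1, ∀ a ∈ unitBall n, ENNReal.ofReal ((1 - r ^ 2) ^ q) *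
      ∫⁻ ξ : UnitSphere n, ‖F (r • (ξ : CSpace n))‖ₑ ^ p *
        ENNReal.ofReal ((1 - ‖ballInvolution a (r • (ξ : CSpace n))‖ ^ 2) ^ s)
          ∂(sphereMeasure n) ≤ C * N ^ p) :
    generalHardyNorm p q s F ≤ C ^ (1 / p) * N := by
  refine iSup₂_le fun r hr => iSup₂_le fun a ha => ?_
  refine (ENNReal.rpow_le_rpow (h r hr a ha) (by positivity)).trans ?_
  rw [ENNReal.mul_rpow_of_nonneg _ _ (by positivity), ← ENNReal.rpow_mul, mul_one_div_cancel hp.ne',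
    ENNReal.rpow_one]

lemma norm_smul_unitSphere {n : ℕ} {r : ℝ} (hr : 0 ≤ r) (ξ : UnitSphere n) :
    ‖r • (ξ : CSpace n)‖ = r := by
  rw [norm_smul, norm_eq_of_mem_sphere ξ, mul_one, Real.norm_of_nonneg hr]

lemma measurable_enorm_rpow_smul {n : ℕ} {F : CSpace n → ℂ}
    (hF : DifferentiableOn ℂ F (unitBall n)) (p : ℝ) {r : ℝ} (hr : r ∈ Ico (0 : ℝ) 1) :
    Measurable fun ξ : UnitSphere n => ‖F (r • (ξ : CSpace n))‖ₑ ^ p := by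
  have := (measurable_indicator_unitBall hF p).comp
    (show Measurable fun ξ : UnitSphere n => r • (ξ : CSpace n) from
      Continuous.measurable (by fun_prop))
  convert this using 1
  ext ξ
  have hxB : r • (ξ : CSpace n) ∈ unitBall n := by
    simpa [unitBall, norm_smul_unitSphere hr.1 ξ] using hr.2
  simp only [Function.comp_apply, indicator_of_mem hxB]

/-- For `q ≥ 0` the Hardy exponent is at most `p`, and the surplus power of the function is absorbed
by its growth at the boundary. -/
lemma exists_generalHardyNorm_le_of_nonneg {n : ℕ} (hn : n ≠ 0) {p q s : ℝ} (hp : 0 < p)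
    (hq : 0 ≤ q) (hs : 0 ≤ s) : ∃ C : ℝ≥0, ∀ F : CSpace n → ℂ,
      DifferentiableOn ℂ F (unitBall n) →
      generalHardyNorm p q s F ≤ C * hardyNorm (p * n / (q + n)) F := by
  have hn0 : (0 : ℝ) < n := by exact_mod_cast Nat.pos_of_ne_zero hn
  set P := p * n / (q + n) with hPdef
  have hP : 0 < P := by positivity
  obtain ⟨C, hC⟩ := exists_growth_generalHardyNorm hn hP 0 le_rfl
  have hqn : 0 ≤ q / n := by positivity
  refine ⟨((C : ℝ≥0) ^ (q / n)) ^ (1 / p), fun F hF => ?_⟩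
  have hcoe : (((C ^ (q / n)) ^ (1 / p) : ℝ≥0) : ℝ≥0∞) = ((C : ℝ≥0∞) ^ (q / n)) ^ (1 / p) := by
    rw [ENNReal.coe_rpow_of_nonneg _ (by positivity), ENNReal.coe_rpow_of_nonneg _ hqn]
  rw [hcoe]
  refine generalHardyNorm_le_of_forall hp fun r hr a ha => ?_
  set N := hardyNorm P F with hN
  have ha1 : ‖a‖ < 1 := by simpa [unitBall] using ha
  have h1r : 0 < 1 - r ^ 2 := by nlinarith [hr.1, hr.2]
  have hexp : P + P * (q / n) = p := by rw [hPdef]; field_simp; ring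
  have hpt : ∀ ξ : UnitSphere n, ENNReal.ofReal ((1 - r ^ 2) ^ q) *
      (‖F (r • (ξ : CSpace n))‖ₑ ^ p *
        ENNReal.ofReal ((1 - ‖ballInvolution a (r • (ξ : CSpace n))‖ ^ 2) ^ s)) ≤
      (C : ℝ≥0∞) ^ (q / n) * N ^ (P * (q / n)) * ‖F (r • (ξ : CSpace n))‖ₑ ^ P := by
    intro ξ
    have hx := norm_smul_unitSphere hr.1 ξ
    have hxB : r • (ξ : CSpace n) ∈ unitBall n := by simpa [unitBall, hx] using hr.2
    have hg := hC F hF _ hxB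
    rw [hx, zero_add, ← hardyNorm_eq_generalHardyNorm, ← hN] at hg
    have hg2 := ENNReal.rpow_le_rpow hg hqn
    rw [ENNReal.mul_rpow_of_nonneg _ _ hqn, ENNReal.mul_rpow_of_nonneg _ _ hqn,
      ← ENNReal.rpow_mul, ← ENNReal.rpow_mul, ENNReal.ofReal_rpow_of_nonneg (by positivity) hqn,
      ← Real.rpow_mul h1r.le, mul_div_cancel₀ _ hn0.ne'] at hg2
    have hle1 : ENNReal.ofReal
        ((1 - ‖ballInvolution a (r • (ξ : CSpace n))‖ ^ 2) ^ s) ≤ 1 := by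
      rw [← ENNReal.ofReal_one]
      refine ENNReal.ofReal_le_ofReal (Real.rpow_le_one ?_ ?_ hs)
      · exact one_sub_norm_sq_ballInvolution_nonneg ha1 (by rw [hx]; exact hr.2.le)
      · nlinarith [sq_nonneg ‖ballInvolution a (r • (ξ : CSpace n))‖]
    calc _ ≤ ENNReal.ofReal ((1 - r ^ 2) ^ q) * (‖F (r • (ξ : CSpace n))‖ₑ ^ p * 1) := by gcongr
      _ = (‖F (r • (ξ : CSpace n))‖ₑ ^ (P * (q / n)) * ENNReal.ofReal ((1 - r ^ 2) ^ q)) *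
          ‖F (r • (ξ : CSpace n))‖ₑ ^ P := by
        rw [mul_one, ← hexp, ENNReal.rpow_add_of_nonneg _ _ hP.le (by positivity)]; ring
      _ ≤ _ := by gcongr
  rw [← lintegral_const_mul' _ _ ENNReal.ofReal_ne_top]
  have hcont := measurable_enorm_rpow_smul hF P hr
  refine (lintegral_mono hpt).trans ?_
  rw [lintegral_const_mul _ hcont]
  refine (mul_le_mul_right (lintegral_le_hardyNorm_rpow hP F hr) _).trans (le_of_eq ?_)
  rw [mul_assoc, ← ENNReal.rpow_add_of_nonneg _ _ (by positivity) hP.le, add_comm, hexp]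

/-- For `q < 0` the Hardy exponent exceeds `p`, and Hölder's inequality reduces the claim to the
integral of the Poisson-Szegő kernel. This is where `q + s ≥ 0` is needed. -/
lemma exists_generalHardyNorm_le_of_neg {n : ℕ} (hn : n ≠ 0) {p q s : ℝ} (hp : 0 < p)
    (hq : q < 0) (hqn : 0 < q + n) (hqs : 0 ≤ q + s) : ∃ C : ℝ≥0, ∀ F : CSpace n → ℂ,
      DifferentiableOn ℂ F (unitBall n) →
      generalHardyNorm p q s F ≤ C * hardyNorm (p * n / (q + n)) F := by
  have hn0 : (0 : ℝ) < n := by exact_mod_cast Nat.pos_of_ne_zero hn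
  set P := p * n / (q + n) with hPdef
  have hP : 0 < P := by positivity
  obtain ⟨C, hC⟩ := exists_lintegral_szego_le hn
  have hqn' : 0 < -q / n := div_pos (by linarith) hn0
  refine ⟨(C ^ (-q / n)) ^ (1 / p), fun F hF => ?_⟩
  have hcoe : (((C ^ (-q / n)) ^ (1 / p) : ℝ≥0) : ℝ≥0∞) = ((C : ℝ≥0∞) ^ (-q / n)) ^ (1 / p) := by
    rw [ENNReal.coe_rpow_of_nonneg _ (by positivity), ENNReal.coe_rpow_of_nonneg _ hqn'.le]
  rw [hcoe]
  refine generalHardyNorm_le_of_forall hp fun r hr a ha => ?_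
  set N := hardyNorm P F with hN
  have ha1 : ‖a‖ < 1 := by simpa [unitBall] using ha
  have h1r : 0 < 1 - r ^ 2 := by nlinarith [hr.1, hr.2]
  have h1a : 0 < 1 - ‖a‖ ^ 2 := by nlinarith [norm_nonneg a]
  have hra : ‖r • a‖ = r * ‖a‖ := by rw [norm_smul, Real.norm_of_nonneg hr.1]
  have hra1 : ‖r • a‖ < 1 := by rw [hra]; nlinarith [norm_nonneg a, hr.1, hr.2]
  have hconj : Real.HolderConjugate (P / p) (n / (-q)) := by
    rw [Real.holderConjugate_iff, hPdef]
    refine ⟨?_, ?_⟩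
    · rw [lt_div_iff₀ hp, lt_div_iff₀ hqn]; nlinarith
    · have hq0 : q ≠ 0 := hq.ne
      have := hqn.ne'
      field_simp
      ring
  set X : UnitSphere n → ℝ := fun ξ => 1 - ‖ballInvolution a (r • (ξ : CSpace n))‖ ^ 2 with hX
  have hin : ∀ ξ : UnitSphere n, (inner ℂ a (r • (ξ : CSpace n)) : ℂ) =
      inner ℂ (r • a) (ξ : CSpace n) := by
    intro ξ
    rw [← Complex.coe_smul, ← Complex.coe_smul, inner_smul_right, inner_smul_left]; simp
  have hXeq : ∀ ξ, X ξ = (1 - ‖a‖ ^ 2) * (1 - r ^ 2) /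
      ‖1 - (inner ℂ (r • a) (ξ : CSpace n) : ℂ)‖ ^ 2 := by
    intro ξ
    have hx := norm_smul_unitSphere hr.1 ξ
    rw [hX]
    simp only
    rw [one_sub_norm_sq_ballInvolution ha1 (by rw [hx]; exact hr.2.le), hx, hin]
  have hden : ∀ ξ : UnitSphere n, 0 < ‖1 - (inner ℂ (r • a) (ξ : CSpace n) : ℂ)‖ := fun ξ =>
    norm_pos_iff.2 (one_sub_inner_ne_zero hra1 (norm_eq_of_mem_sphere ξ).le)
  have hX0 : ∀ ξ, 0 < X ξ := fun ξ => by
    rw [hXeq]; have := hden ξ; positivity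
  have hX1 : ∀ ξ, X ξ ≤ 1 := fun ξ => by
    simp only [hX]; nlinarith [sq_nonneg ‖ballInvolution a (r • (ξ : CSpace n))‖]
  have hXm : Measurable X := by
    have : X = fun ξ : UnitSphere n => (1 - ‖a‖ ^ 2) * (1 - r ^ 2) /
      ‖1 - (inner ℂ (r • a) (ξ : CSpace n) : ℂ)‖ ^ 2 := funext hXeq
    rw [this]
    have c1 : Continuous fun ξ : UnitSphere n =>
      ‖1 - (inner ℂ (r • a) (ξ : CSpace n) : ℂ)‖ ^ 2 := by fun_prop
    exact measurable_const.div c1.measurable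
  have hFm := measurable_enorm_rpow_smul hF p hr
  -- The kernel integral: `X ^ n` is the Poisson-Szegő kernel up to the factor `(1 - r²)^n`.
  have hker : ∫⁻ ξ, ENNReal.ofReal (X ξ ^ n) ∂(sphereMeasure n) ≤
      C * ENNReal.ofReal ((1 - r ^ 2) ^ n) := by
    have e1 : ∀ ξ, ENNReal.ofReal (X ξ ^ n) = ENNReal.ofReal (((1 - ‖a‖ ^ 2) * (1 - r ^ 2)) ^ n) *
        ENNReal.ofReal ((‖1 - (inner ℂ (r • a) (ξ : CSpace n) : ℂ)‖ ^ (2 * n))⁻¹) := by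
      intro ξ
      rw [hXeq, ← ENNReal.ofReal_mul (by positivity), div_pow, ← pow_mul, div_eq_mul_inv]
    simp_rw [e1]
    rw [lintegral_const_mul' _ _ ENNReal.ofReal_ne_top]
    refine (mul_le_mul_right (hC _ hra1) _).trans ?_
    rw [mul_left_comm, ← ENNReal.ofReal_mul (by positivity)]
    gcongr
    have h1 : 0 < 1 - ‖r • a‖ ^ 2 := by nlinarith [norm_nonneg (r • a)]
    have h2 : 1 - ‖a‖ ^ 2 ≤ 1 - ‖r • a‖ ^ 2 := by
      rw [hra, mul_pow]
      nlinarith [sq_nonneg ‖a‖]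
    rw [← inv_pow, ← mul_pow]
    gcongr
    rw [mul_right_comm, ← div_eq_mul_inv]
    have h3 : (1 - ‖a‖ ^ 2) / (1 - ‖r • a‖ ^ 2) ≤ 1 := (div_le_one h1).2 h2
    nlinarith
  calc ENNReal.ofReal ((1 - r ^ 2) ^ q) *
      ∫⁻ ξ : UnitSphere n, ‖F (r • (ξ : CSpace n))‖ₑ ^ p * ENNReal.ofReal (X ξ ^ s)
        ∂(sphereMeasure n)
      ≤ ENNReal.ofReal ((1 - r ^ 2) ^ q) *
      ∫⁻ ξ : UnitSphere n, ‖F (r • (ξ : CSpace n))‖ₑ ^ p * ENNReal.ofReal (X ξ ^ (-q))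
        ∂(sphereMeasure n) := by
        refine mul_le_mul_right (lintegral_mono fun ξ => mul_le_mul_right
          (ENNReal.ofReal_le_ofReal ?_) _) _
        exact Real.rpow_le_rpow_of_exponent_ge (hX0 ξ) (hX1 ξ) (by linarith)
    _ ≤ ENNReal.ofReal ((1 - r ^ 2) ^ q) *
      ((∫⁻ ξ : UnitSphere n, (‖F (r • (ξ : CSpace n))‖ₑ ^ p) ^ (P / p)
          ∂(sphereMeasure n)) ^ (1 / (P / p)) *
        (∫⁻ ξ : UnitSphere n, ENNReal.ofReal (X ξ ^ (-q)) ^ (n / (-q))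
          ∂(sphereMeasure n)) ^ (1 / (n / (-q)))) := by
        gcongr
        exact ENNReal.lintegral_mul_le_Lp_mul_Lq _ hconj hFm.aemeasurable
          (hXm.pow_const _).ennreal_ofReal.aemeasurable
    _ ≤ ENNReal.ofReal ((1 - r ^ 2) ^ q) *
      ((N ^ P) ^ (1 / (P / p)) * (C * ENNReal.ofReal ((1 - r ^ 2) ^ n)) ^ (-q / n)) := by
        have e1 : ∀ ξ : UnitSphere n, (‖F (r • (ξ : CSpace n))‖ₑ ^ p) ^ (P / p) =
            ‖F (r • (ξ : CSpace n))‖ₑ ^ P := fun ξ => by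
          rw [← ENNReal.rpow_mul, mul_div_cancel₀ _ hp.ne']
        have e2 : ∀ ξ : UnitSphere n, ENNReal.ofReal (X ξ ^ (-q)) ^ (n / (-q)) =
            ENNReal.ofReal (X ξ ^ n) := fun ξ => by
          have := hX0 ξ
          rw [ENNReal.ofReal_rpow_of_nonneg (by positivity) hconj.symm.nonneg,
            ← Real.rpow_mul this.le, mul_div_cancel₀ _ (by linarith), Real.rpow_natCast]
        simp_rw [e1, e2]
        rw [one_div_div (n : ℝ)]
        gcongr
        exact lintegral_le_hardyNorm_rpow hP F hr
    _ = (C : ℝ≥0∞) ^ (-q / n) * N ^ p := by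
        have e3 : (N ^ P) ^ (1 / (P / p)) = N ^ p := by
          rw [← ENNReal.rpow_mul]; congr 1; field_simp
        have e4 : ENNReal.ofReal ((1 - r ^ 2) ^ n) ^ (-q / n) =
            ENNReal.ofReal ((1 - r ^ 2) ^ (-q)) := by
          rw [ENNReal.ofReal_rpow_of_nonneg (by positivity) hqn'.le, ← Real.rpow_natCast,
            ← Real.rpow_mul h1r.le, mul_div_cancel₀ _ hn0.ne']
        have e5 : ENNReal.ofReal ((1 - r ^ 2) ^ q) * ENNReal.ofReal ((1 - r ^ 2) ^ (-q)) = 1 := by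
          rw [← ENNReal.ofReal_mul (by positivity), ← Real.rpow_add h1r, add_neg_cancel,
            Real.rpow_zero, ENNReal.ofReal_one]
        rw [e3, ENNReal.mul_rpow_of_nonneg _ _ hqn'.le, e4]
        calc _ = (ENNReal.ofReal ((1 - r ^ 2) ^ q) * ENNReal.ofReal ((1 - r ^ 2) ^ (-q))) *
              ((C : ℝ≥0∞) ^ (-q / n) * N ^ p) := by ring
          _ = _ := by rw [e5, one_mul]

/-- The Hardy space of exponent `p n / (q + n)` embeds boundedly in `H^{p,q,s}`. -/
theorem exists_generalHardyNorm_le_hardyNorm {n : ℕ} (hn : n ≠ 0) {p q s : ℝ} (hp : 0 < p)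
    (hs : 0 ≤ s) (hqn : 0 < q + n) (hqs : 0 ≤ q + s) : ∃ C : ℝ≥0, ∀ F : CSpace n → ℂ,
      DifferentiableOn ℂ F (unitBall n) →
      generalHardyNorm p q s F ≤ C * hardyNorm (p * n / (q + n)) F := by
  rcases le_or_gt 0 q with hq | hq
  · exact exists_generalHardyNorm_le_of_nonneg hn hp hq hs
  · exact exists_generalHardyNorm_le_of_neg hn hp hq hqn hqs

/-! ### Test functions -/

/-- The function `z ↦ ((1 - |b|²) / (1 - ⟨z, b⟩)²)^κ`, a power of a normalized Szegő kernel
concentrated near `b`. It is holomorphic in the ball, where `1 - ⟨z, b⟩` has positive real part, so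
that the principal branch of the power applies. -/
noncomputable def szegoPower {n : ℕ} (κ : ℝ) (b z : CSpace n) : ℂ :=
  (((1 - ‖b‖ ^ 2) ^ κ : ℝ) : ℂ) * (1 - (inner ℂ b z : ℂ)) ^ (((-(2 * κ) : ℝ)) : ℂ)

lemma differentiableOn_szegoPower {n : ℕ} (κ : ℝ) {b : CSpace n} (hb : ‖b‖ < 1) :
    DifferentiableOn ℂ (szegoPower κ b) (unitBall n) := by
  intro z hz
  have hz1 : ‖z‖ < 1 := by simpa [unitBall] using hz
  have h1 := norm_inner_le_norm (𝕜 := ℂ) b z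
  have h2 : ‖(inner ℂ b z : ℂ)‖ < 1 := by nlinarith [norm_nonneg b, norm_nonneg z]
  have hslit : (1 : ℂ) - inner ℂ b z ∈ Complex.slitPlane := by
    left
    have := Complex.re_le_norm (inner ℂ b z : ℂ)
    simp only [Complex.sub_re, Complex.one_re]
    linarith
  have hd : DifferentiableAt ℂ (fun z : CSpace n => (1 : ℂ) - inner ℂ b z) z :=
    ((innerSL ℂ b).differentiableAt).const_sub 1
  exact ((hd.cpow_const hslit).const_mul _).differentiableWithinAt

lemma norm_szegoPower {n : ℕ} (κ : ℝ) {b : CSpace n} (hb : ‖b‖ < 1) (z : CSpace n) :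
    ‖szegoPower κ b z‖ =
      (1 - ‖b‖ ^ 2) ^ κ * ‖1 - (inner ℂ b z : ℂ)‖ ^ (-(2 * κ)) := by
  have h1b : 0 < 1 - ‖b‖ ^ 2 := by nlinarith [norm_nonneg b]
  rw [szegoPower, norm_mul, Complex.norm_cpow_real, Complex.norm_real,
    Real.norm_of_nonneg (by positivity)]

lemma norm_szegoPower_self {n : ℕ} (κ : ℝ) {b : CSpace n} (hb : ‖b‖ < 1) :
    ‖szegoPower κ b b‖ = (1 - ‖b‖ ^ 2) ^ (-κ) := by
  have h1b : 0 < 1 - ‖b‖ ^ 2 := by nlinarith [norm_nonneg b]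
  have h1 : (1 : ℂ) - inner ℂ b b = ((1 - ‖b‖ ^ 2 : ℝ) : ℂ) := by
    rw [inner_self_eq_norm_sq_to_K]; simp
  rw [norm_szegoPower κ hb, h1, Complex.norm_real, Real.norm_of_nonneg h1b.le,
    ← Real.rpow_add h1b]
  congr 1; ring

lemma exists_hardyNorm_szegoPower_le {n : ℕ} (hn : n ≠ 0) {P : ℝ} (hP : 0 < P) :
    ∃ M : ℝ≥0, ∀ b : CSpace n, ‖b‖ < 1 → hardyNorm P (szegoPower (n / P) b) ≤ M := by
  obtain ⟨C, hC⟩ := exists_lintegral_szego_le hn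
  refine ⟨C ^ (1 / P), fun b hb => ?_⟩
  rw [ENNReal.coe_rpow_of_nonneg _ (by positivity)]
  refine iSup₂_le fun r hr => ?_
  refine ENNReal.rpow_le_rpow ?_ (by positivity)
  have h1b : 0 < 1 - ‖b‖ ^ 2 := by nlinarith [norm_nonneg b]
  have hrb : ‖r • b‖ = r * ‖b‖ := by rw [norm_smul, Real.norm_of_nonneg hr.1]
  have hrb1 : ‖r • b‖ < 1 := by rw [hrb]; nlinarith [norm_nonneg b, hr.1, hr.2]
  have hpt : ∀ ξ : UnitSphere n, ‖szegoPower (n / P) b (r • (ξ : CSpace n))‖ₑ ^ P =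
      ENNReal.ofReal ((1 - ‖b‖ ^ 2) ^ n) *
        ENNReal.ofReal ((‖1 - (inner ℂ (r • b) (ξ : CSpace n) : ℂ)‖ ^ (2 * n))⁻¹) := by
    intro ξ
    have hin : (inner ℂ b (r • (ξ : CSpace n)) : ℂ) = inner ℂ (r • b) (ξ : CSpace n) := by
      rw [← Complex.coe_smul, ← Complex.coe_smul, inner_smul_right, inner_smul_left]; simp
    rw [← ofReal_norm, norm_szegoPower _ hb, hin,
      ENNReal.ofReal_rpow_of_nonneg (by positivity) hP.le, ← ENNReal.ofReal_mul (by positivity),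
      Real.mul_rpow (by positivity) (by positivity), ← Real.rpow_mul h1b.le,
      ← Real.rpow_mul (norm_nonneg _), div_mul_cancel₀ _ hP.ne', Real.rpow_natCast]
    have e : -(2 * ((n : ℝ) / P)) * P = -((2 * n : ℕ) : ℝ) := by
      push_cast; field_simp
    rw [e, Real.rpow_neg (norm_nonneg _), Real.rpow_natCast]
  simp_rw [hpt]
  rw [lintegral_const_mul' _ _ ENNReal.ofReal_ne_top]
  refine (mul_le_mul_right (hC _ hrb1) _).trans ?_
  rw [mul_left_comm, ← ENNReal.ofReal_mul (by positivity)]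
  refine mul_le_of_le_one_right' ?_
  rw [← ENNReal.ofReal_one]
  apply ENNReal.ofReal_le_ofReal
  have h2 : 1 - ‖b‖ ^ 2 ≤ 1 - ‖r • b‖ ^ 2 := by
    have h4 : ‖r • b‖ ≤ ‖b‖ := by
      rw [hrb]; exact mul_le_of_le_one_left (norm_nonneg b) hr.2.le
    gcongr
  have h3 : 0 < 1 - ‖r • b‖ ^ 2 := by linarith
  rw [← div_eq_mul_inv, div_le_one (by positivity)]
  gcongr

/-- The test functions tend to zero pointwise in the ball as `|b| → 1`. -/
lemma tendsto_szegoPower_zero {n : ℕ} {κ : ℝ} (hκ : 0 < κ) {b : ℕ → CSpace n}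
    (hb : ∀ k, ‖b k‖ < 1) (hb1 : Tendsto (fun k => 1 - ‖b k‖ ^ 2) atTop (𝓝 0)) {z : CSpace n}
    (hz : ‖z‖ < 1) : Tendsto (fun k => szegoPower κ (b k) z) atTop (𝓝 0) := by
  have hlim : Tendsto (fun k => (1 - ‖b k‖ ^ 2) ^ κ * (1 - ‖z‖) ^ (-(2 * κ))) atTop (𝓝 0) := by
    have h1 := hb1.rpow_const (p := κ) (Or.inr hκ.le)
    rw [Real.zero_rpow hκ.ne'] at h1
    simpa using h1.mul_const ((1 - ‖z‖) ^ (-(2 * κ)))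
  refine squeeze_zero_norm (fun k => ?_) hlim
  rw [norm_szegoPower κ (hb k)]
  have h1b : 0 < 1 - ‖b k‖ ^ 2 := by nlinarith [norm_nonneg (b k), hb k]
  have hle : 1 - ‖z‖ ≤ ‖1 - (inner ℂ (b k) z : ℂ)‖ := by
    have h1 := norm_inner_le_norm (𝕜 := ℂ) (b k) z
    have h2 := norm_sub_norm_le (1 : ℂ) (inner ℂ (b k) z)
    rw [norm_one] at h2
    nlinarith [norm_nonneg z, hb k]
  have hz0 : 0 < 1 - ‖z‖ := by linarith
  refine mul_le_mul_of_nonneg_left ?_ (by positivity)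
  exact Real.rpow_le_rpow_of_nonpos hz0 hle (by linarith)

/-! ### The two implications -/

/-- Norm convergence to zero in `H^{p,q,s}` forces the values to tend to zero, even along moving
points `w k` when weighted by the power of `1 - ‖w k‖²` from the growth estimate. -/
lemma tendsto_zero_of_generalHardyNorm {n : ℕ} (hn : n ≠ 0) {p q s : ℝ} (hp : 0 < p) (hs : 0 ≤ s)
    {f : ℕ → CSpace n → ℂ} (hf : ∀ k, DifferentiableOn ℂ (f k) (unitBall n))
    (hlim : Tendsto (fun k => generalHardyNorm p q s (f k)) atTop (𝓝 0)) {w : ℕ → CSpace n}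
    (hw : ∀ k, w k ∈ unitBall n) :
    Tendsto (fun k => ‖f k (w k)‖ₑ ^ p * ENNReal.ofReal ((1 - ‖w k‖ ^ 2) ^ (q + n)))
      atTop (𝓝 0) := by
  obtain ⟨C, hC⟩ := exists_growth_generalHardyNorm hn hp q hs
  have h1 : Tendsto (fun k => (C : ℝ≥0∞) * generalHardyNorm p q s (f k) ^ p) atTop (𝓝 0) := by
    have h2 := (ENNReal.continuous_rpow_const (y := p)).tendsto 0 |>.comp hlim
    rw [ENNReal.zero_rpow_of_pos hp] at h2
    simpa using ENNReal.Tendsto.const_mul h2 (Or.inr ENNReal.coe_ne_top)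
  exact tendsto_of_tendsto_of_tendsto_of_le_of_le tendsto_const_nhds h1 (fun k => zero_le)
    fun k => hC _ (hf k) _ (hw k)

/-- If `(1 - |w|²) / (1 - |φ(w)|²)` does not tend to zero, the images of the test functions
concentrated near the points `φ(w_k)` tend to zero pointwise, but their norms do not. -/
theorem littleOCondition_of_isCompactBetween {n : ℕ} (hn : n ≠ 0) {p q s : ℝ} (hp : 0 < p)
    (hs : 0 ≤ s) (hqn : 0 < q + n) {φ : CSpace n → CSpace n}
    (hφB : MapsTo φ (unitBall n) (unitBall n))
    (hcomp : IsCompactBetween (hardySpace n (p * n / (q + n))) (hardyNorm (p * n / (q + n)))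
      (generalHardySpace n p q s) (generalHardyNorm p q s) (compositionOperator φ)) :
    LittleOCondition φ := by
  have hn0 : (0 : ℝ) < n := by exact_mod_cast Nat.pos_of_ne_zero hn
  set P := p * n / (q + n) with hPdef
  have hP : 0 < P := by positivity
  have hκ : (n : ℝ) / P = (q + n) / p := by rw [hPdef]; field_simp
  have hmem : ∀ {x : CSpace n}, x ∈ unitBall n ↔ ‖x‖ < 1 := by simp [unitBall]
  by_contra hnot
  set G : Filter (CSpace n) := comap (fun w : CSpace n => ‖w‖) (𝓝[<] (1 : ℝ)) with hG
  have hGball : ∀ᶠ w in G, ‖w‖ < 1 :=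
    (eventually_mem_nhdsWithin (a := (1 : ℝ)) (s := Iio 1)).comap _
  have hratio : ∀ x : CSpace n, ‖x‖ < 1 → 0 < 1 - ‖x‖ ^ 2 := fun x hx => by
    nlinarith [norm_nonneg x]
  -- Points at which the quotient stays away from zero.
  obtain ⟨ε, hε, hfreq⟩ : ∃ ε > 0, ∃ᶠ w in G,
      ‖w‖ < 1 ∧ ε ≤ (1 - ‖w‖ ^ 2) / (1 - ‖φ w‖ ^ 2) := by
    by_contra! hcon
    refine hnot (Metric.tendsto_nhds.2 fun ε hε => ?_)
    filter_upwards [hcon ε hε, hGball] with w hw hwB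
    have hb := hφB (hmem.2 hwB)
    have h2 := div_pos (hratio w hwB) (hratio _ (hmem.1 hb))
    rw [Real.dist_0_eq_abs, abs_of_pos h2]
    exact hw hwB
  obtain ⟨w, hwG, hw⟩ := exists_seq_forall_of_frequently hfreq
  have hwlim : Tendsto (fun k => ‖w k‖) atTop (𝓝 1) :=
    (tendsto_comap.comp hwG).mono_right nhdsWithin_le_nhds
  have hwlim2 : Tendsto (fun k => 1 - ‖w k‖ ^ 2) atTop (𝓝 0) := by
    simpa using (hwlim.pow 2).const_sub 1
  have hwB : ∀ k, w k ∈ unitBall n := fun k => hmem.2 (hw k).1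
  set b : ℕ → CSpace n := fun k => φ (w k) with hb
  have hb1 : ∀ k, ‖b k‖ < 1 := fun k => hmem.1 (hφB (hwB k))
  have hquot : ∀ k, 1 - ‖b k‖ ^ 2 ≤ (1 - ‖w k‖ ^ 2) / ε := fun k => by
    rw [le_div_iff₀ hε, mul_comm]
    exact (le_div_iff₀ (hratio _ (hb1 k))).1 (hw k).2
  have hblim : Tendsto (fun k => 1 - ‖b k‖ ^ 2) atTop (𝓝 0) := by
    refine squeeze_zero (fun k => (hratio _ (hb1 k)).le) hquot ?_
    simpa using hwlim2.div_const ε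
  obtain ⟨M, hM⟩ := exists_hardyNorm_szegoPower_le hn hP
  set u : ℕ → CSpace n → ℂ := fun k => szegoPower (n / P) (b k) with hu
  have huX : ∀ k, u k ∈ hardySpace n P := fun k =>
    ⟨differentiableOn_szegoPower _ (hb1 k), (hM _ (hb1 k)).trans_lt ENNReal.coe_lt_top⟩
  obtain ⟨g, hg, ψ, hψ, hlim⟩ := hcomp.2 u huX ⟨M, fun k => hM _ (hb1 k)⟩
  set f : ℕ → CSpace n → ℂ := fun k => compositionOperator φ (u (ψ k)) - g with hf
  have hfd : ∀ k, DifferentiableOn ℂ (f k) (unitBall n) := fun k =>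
    (hcomp.1 (huX (ψ k))).1.sub hg.1
  -- The limit function vanishes in the ball.
  have hg0 : ∀ z ∈ unitBall n, g z = 0 := by
    intro z hz
    have h1 := tendsto_zero_of_generalHardyNorm hn hp hs hfd hlim (w := fun _ => z) fun _ => hz
    have hz1 := hmem.1 hz
    have h2 : Tendsto (fun k => u (ψ k) (φ z)) atTop (𝓝 0) :=
      (tendsto_szegoPower_zero (by positivity) hb1 hblim (hmem.1 (hφB hz))).comp hψ.tendsto_atTop
    have h3 : Tendsto (fun k => f k z) atTop (𝓝 (0 - g z)) := h2.sub_const (g z)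
    have h4 : Tendsto (fun k => ‖f k z‖ₑ ^ p * ENNReal.ofReal ((1 - ‖z‖ ^ 2) ^ (q + n))) atTop
        (𝓝 (‖0 - g z‖ₑ ^ p * ENNReal.ofReal ((1 - ‖z‖ ^ 2) ^ (q + n)))) :=
      ENNReal.Tendsto.mul_const
        ((ENNReal.continuous_rpow_const.tendsto _).comp
          ((continuous_enorm.tendsto _).comp h3)) (Or.inr ENNReal.ofReal_ne_top)
    have h5 := tendsto_nhds_unique h4 h1
    have hpos : 0 < (1 - ‖z‖ ^ 2) ^ (q + n) := Real.rpow_pos_of_pos (hratio z hz1) _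
    rw [mul_eq_zero, ENNReal.rpow_eq_zero_iff_of_pos hp, ENNReal.ofReal_eq_zero] at h5
    rcases h5 with h5 | h5
    · simpa using h5
    · exact absurd hpos (not_lt.2 h5)
  have h6 := tendsto_zero_of_generalHardyNorm hn hp hs hfd hlim (w := fun k => w (ψ k))
    fun k => hwB _
  -- At `w_k` the quantity in the growth estimate is the quotient to the power `q + n`.
  have h7 : ∀ k, ENNReal.ofReal (ε ^ (q + n)) ≤
      ‖f k (w (ψ k))‖ₑ ^ p * ENNReal.ofReal ((1 - ‖w (ψ k)‖ ^ 2) ^ (q + n)) := by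
    intro k
    have hB := hratio _ (hb1 (ψ k))
    have hW := hratio _ (hw (ψ k)).1
    have e1 : f k (w (ψ k)) = szegoPower (n / P) (b (ψ k)) (b (ψ k)) := by
      simp [hf, hu, hb, compositionOperator, hg0 _ (hwB (ψ k))]
    rw [e1, ← ofReal_norm, norm_szegoPower_self _ (hb1 _),
      ENNReal.ofReal_rpow_of_nonneg (by positivity) hp.le, ← Real.rpow_mul hB.le, hκ,
      ← ENNReal.ofReal_mul (by positivity)]
    apply ENNReal.ofReal_le_ofReal
    have e2 : -((q + n) / p) * p = -(q + n) := by field_simp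
    rw [e2, Real.rpow_neg hB.le, ← Real.inv_rpow hB.le, ← Real.mul_rpow (by positivity) hW.le,
      inv_mul_eq_div]
    exact Real.rpow_le_rpow hε.le (hw (ψ k)).2 hqn.le
  have h8 := ge_of_tendsto' h6 h7
  rw [nonpos_iff_eq_zero, ENNReal.ofReal_eq_zero] at h8
  exact absurd (Real.rpow_pos_of_pos hε (q + n)) (not_lt.2 h8)

/-- Compactness on the Hardy space passes to the larger space along the bounded embedding. -/
theorem isCompactBetween_of_isCompactBetween_hardySpace {n : ℕ} (hn : n ≠ 0) {p q s : ℝ}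
    (hp : 0 < p) (hs : 0 ≤ s) (hqn : 0 < q + n) (hqs : 0 ≤ q + s) {φ : CSpace n → CSpace n}
    (hcomp : IsCompactBetween (hardySpace n (p * n / (q + n))) (hardyNorm (p * n / (q + n)))
      (hardySpace n (p * n / (q + n))) (hardyNorm (p * n / (q + n))) (compositionOperator φ)) :
    IsCompactBetween (hardySpace n (p * n / (q + n))) (hardyNorm (p * n / (q + n)))
      (generalHardySpace n p q s) (generalHardyNorm p q s) (compositionOperator φ) := by
  obtain ⟨C, hC⟩ := exists_generalHardyNorm_le_hardyNorm hn hp hs hqn hqs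
  have hsub : hardySpace n (p * n / (q + n)) ⊆ generalHardySpace n p q s := fun h hh =>
    ⟨hh.1, (hC h hh.1).trans_lt (ENNReal.mul_lt_top ENNReal.coe_lt_top hh.2)⟩
  refine ⟨fun h hh => hsub (hcomp.1 hh), fun u hu hM => ?_⟩
  obtain ⟨g, hg, ψ, hψ, hlim⟩ := hcomp.2 u hu hM
  refine ⟨g, hsub hg, ψ, hψ, ?_⟩
  have h1 := ENNReal.Tendsto.const_mul (a := (C : ℝ≥0∞)) hlim (Or.inr ENNReal.coe_ne_top)
  rw [mul_zero] at h1
  exact tendsto_of_tendsto_of_tendsto_of_le_of_le tendsto_const_nhds h1 (fun k => zero_le)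
    fun k => hC _ ((hcomp.1 (hu (ψ k))).1.sub hg.1)

theorem theorem3p2 (n : ℕ) (p q s : ℝ) (hp : 0 < p) (hs : 0 < s) (hsn : s < n) (hqs : 0 ≤ q + s)
    (φ : CSpace n → CSpace n) (hφ : DifferentiableOn ℂ φ (unitBall n))
    (hφB : MapsTo φ (unitBall n) (unitBall n)) :
    (IsCompactBetween (hardySpace n (p * n / (q + n))) (hardyNorm (p * n / (q + n)))
        (generalHardySpace n p q s) (generalHardyNorm p q s) (compositionOperator φ) →
      LittleOCondition φ) ∧
    (IsCompactBetween (hardySpace n (p * n / (q + n))) (hardyNorm (p * n / (q + n)))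
        (hardySpace n (p * n / (q + n))) (hardyNorm (p * n / (q + n))) (compositionOperator φ) →
      IsCompactBetween (hardySpace n (p * n / (q + n))) (hardyNorm (p * n / (q + n)))
        (generalHardySpace n p q s) (generalHardyNorm p q s) (compositionOperator φ)) := by
  have hn : n ≠ 0 := by
    rintro rfl
    simp only [Nat.cast_zero] at hsn
    linarith
  have hqn : 0 < q + n := by linarith
  exact ⟨littleOCondition_of_isCompactBetween hn hp hs.le hqn hφB,
    isCompactBetween_of_isCompactBetween_hardySpace hn hp hs.le hqn hqs⟩
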